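/- Let $(M,h)$ be a smooth Lorentzian manifold (Hausdorff, second countable, signature $(-,+,\dots,+)$) with Levi-Civita connection $\nabla$. Write $R(U,V)W=\nabla_U\nabla_VW-\nabla_V\nabla_UW-\nabla_{[U,V]}W$ and $R(U,V,W,Z)=h(R(U,V)W,Z)$, let $\mathrm{Ric}$ be the metric trace of $R$ over its first and third arguments, and define the Ricci endomorphism by $h(\mathrm{Ric}(U),V)=\mathrm{Ric}(U,V)$. * $(M,h)$ is *Ricci-isotropic* if $h(\mathrm{Ric}(U),\mathrm{Ric}(V))=0$ for all tangent vectors $U,V$ at the same point. * A vector field $X$ is *lightlike* if it is smooth, nowhere zero and $h(X,X)=0$. * $(M,h)$ is a *pp-wave* if it admits a lightlike vector field $X$ with $\nabla X=0$ and $\mathrm{tr}_{(3,5)(4,6)}(R\otimes R)=0$, the trace being taken with $h$ over the indicated pairs of arguments. It is *locally a pp-wave* if every point has an open neighbourhood which, with the restricted metric, is a pp-wave. * A *pr-field* on $(M,h)$ is a lightlike vector field $X$ with $\nabla X=\Theta\otimes X$ for a smooth one-form $\Theta$ (the recurrence form of $X$), such that $R(U,V)$ maps $X^\perp$ into $\mathbb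 R X$ for all $U,V$. $(M,h)$ is a *pr-wave* if it admits a pr-field. **Proposition 6.11.** Let $(M,h)$ be a pr-wave. 1. $(M,h)$ is locally a pp-wave if and only if it is Ricci-isotropic. 2. If $M$ is simply connected, then $(M,h)$ is a pp-wave if and only if it is Ricci-isotropic. 3. Suppose that $(M,h)$ is Ricci-isotropic and let $X$ be any pr-field on it, with recurrence form $\Theta$. Then $d\Theta=0$; every point has an open neighbourhood $U$ with a smooth function $f>0$ on $U$ such that $fX$ is parallel on $U$; and if $M$ is simply connected, one can take $U=M$. -/

import Mathlib

open Bundle FiberBundle VectorField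
open scoped Manifold ContDiff Topology

/-- A smooth Lorentzian metric on a `d`-dimensional manifold `M`, signature `(-,+,...,+)`: a smooth
field of symmetric bilinear forms on the tangent spaces, such that every tangent space contains a
timelike vector on whose orthogonal complement the form is positive definite. -/
structure LorentzianMetric (d : ℕ) (M : Type*) [TopologicalSpace M]
    [ChartedSpace (EuclideanSpace ℝ (Fin d)) M] [IsManifold (𝓡 d) ∞ M] where
  /-- The bilinear form at a point. -/
  val (x : M) : TangentSpace (𝓡 d) x →L[ℝ] TangentSpace (𝓡 d) x →L[ℝ] ℝ
  symm (x : M) (v w : TangentSpace (𝓡 d) x) : val x v w = val x w v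
  index_one (x : M) : ∃ t : TangentSpace (𝓡 d) x, val x t t < 0 ∧
    ∀ w : TangentSpace (𝓡 d) x, val x t w = 0 → w ≠ 0 → 0 < val x w w
  contMDiff : ContMDiff (𝓡 d)
    ((𝓡 d).prod 𝓘(ℝ, EuclideanSpace ℝ (Fin d) →L[ℝ] EuclideanSpace ℝ (Fin d) →L[ℝ] ℝ)) ∞
    (fun x ↦ TotalSpace.mk'
      (EuclideanSpace ℝ (Fin d) →L[ℝ] EuclideanSpace ℝ (Fin d) →L[ℝ] ℝ) x (val x))

section

variable {d : ℕ} {M : Type*} [TopologicalSpace M]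
  [ChartedSpace (EuclideanSpace ℝ (Fin d)) M] [IsManifold (𝓡 d) ∞ M]

/-- The vector field `X` is differentiable at `x`. -/
abbrev DiffFieldAt (X : Π x : M, TangentSpace (𝓡 d) x) (x : M) : Prop :=
  MDifferentiableAt (𝓡 d) ((𝓡 d).prod 𝓘(ℝ, EuclideanSpace ℝ (Fin d)))
    (fun y ↦ (⟨y, X y⟩ : TangentBundle (𝓡 d) M)) x

/-- The vector field `X` is smooth on the set `U`. -/
abbrev SmoothFieldOn (X : Π x : M, TangentSpace (𝓡 d) x) (U : Set M) : Prop :=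
  ContMDiffOn (𝓡 d) ((𝓡 d).prod 𝓘(ℝ, EuclideanSpace ℝ (Fin d))) ∞
    (fun y ↦ (⟨y, X y⟩ : TangentBundle (𝓡 d) M)) U

/-- An affine connection on `M`, that is, a covariant derivative on the tangent bundle.
Mathlib's argument order: `∇ Y x u` is `(∇_u Y)(x)` for `u` a tangent vector at `x`. -/
abbrev AffineConnection (d : ℕ) (M : Type*) [TopologicalSpace M]
    [ChartedSpace (EuclideanSpace ℝ (Fin d)) M] [IsManifold (𝓡 d) ∞ M] :=
  CovariantDerivative (𝓡 d) (EuclideanSpace ℝ (Fin d)) (TangentSpace (𝓡 d) : M → Type _)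

/-- `∇` is the Levi-Civita connection of `h`: smooth, torsion free and metric. -/
structure LorentzianMetric.IsLeviCivita (h : LorentzianMetric d M) (nab : AffineConnection d M) :
    Prop where
  smooth : nab.ContMDiffCovariantDerivative ∞
  torsion_free : ∀ (X Y : Π x : M, TangentSpace (𝓡 d) x) (x : M),
    DiffFieldAt X x → DiffFieldAt Y x →
      nab Y x (X x) - nab X x (Y x) = mlieBracket (𝓡 d) X Y x
  metric : ∀ (Y Z : Π x : M, TangentSpace (𝓡 d) x) (x : M) (u : TangentSpace (𝓡 d) x),
    DiffFieldAt Y x → DiffFieldAt Z x →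
      mvfderiv (𝓡 d) (fun y ↦ h.val y (Y y) (Z y)) x u
        = h.val x (nab Y x u) (Z x) + h.val x (Y x) (nab Z x u)

/-- The curvature `R(X,Y)Z = ∇_X ∇_Y Z - ∇_Y ∇_X Z - ∇_[X,Y] Z` on vector fields. -/
noncomputable def curvatureField (nab : AffineConnection d M) (X Y Z : Π x : M, TangentSpace (𝓡 d) x) :
    Π x : M, TangentSpace (𝓡 d) x := fun x ↦
  nab (fun y ↦ nab Z y (Y y)) x (X x) - nab (fun y ↦ nab Z y (X y)) x (Y x)
    - nab Z x (mlieBracket (𝓡 d) X Y x)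

/-- The curvature endomorphism `w ↦ R(u,v)w` at a point, computed on the standard extensions of
`u`, `v`, `w` to vector fields that are smooth near `x`. (By tensoriality the value does not depend
on the choice of the extensions.) -/
noncomputable def curv (nab : AffineConnection d M) (x : M) (u v w : TangentSpace (𝓡 d) x) :
    TangentSpace (𝓡 d) x :=
  curvatureField nab (extend (EuclideanSpace ℝ (Fin d)) u) (extend (EuclideanSpace ℝ (Fin d)) v)
    (extend (EuclideanSpace ℝ (Fin d)) w) x

namespace LorentzianMetric

variable (h : LorentzianMetric d M) (nab : AffineConnection d M)

/-- The `(4,0)` curvature tensor `R(u,v,w,z) = h(R(u,v)w, z)`. -/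
noncomputable def curv4 (x : M) (u v w z : TangentSpace (𝓡 d) x) : ℝ :=
  h.val x (curv nab x u v w) z

/-- The metric at a point as an algebraic bilinear form. -/
noncomputable def bilin (x : M) : LinearMap.BilinForm ℝ (TangentSpace (𝓡 d) x) :=
  (h.val x).toLinearMap₁₂

@[simp]
theorem bilin_apply (x : M) (v w : TangentSpace (𝓡 d) x) : h.bilin x v w = h.val x v w := rfl

theorem bilin_nondegenerate (x : M) : (h.bilin x).Nondegenerate := by
  have key : ∀ u : TangentSpace (𝓡 d) x, (∀ w, h.val x u w = 0) → u = 0 := by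
    intro u hu
    obtain ⟨t, -, ht⟩ := h.index_one x
    by_contra hne
    have h1 := ht u (by rw [h.symm]; exact hu t) hne
    rw [hu u] at h1
    exact lt_irrefl _ h1
  refine ⟨fun u hu ↦ key u hu, fun u hu ↦ key u fun w ↦ ?_⟩
  rw [h.symm]
  exact hu w

/-- A basis of the tangent space. -/
noncomputable def basis (x : M) :
    Module.Basis (Fin d) ℝ (TangentSpace (𝓡 d) x) :=
  (EuclideanSpace.basisFun (Fin d) ℝ).toBasis

/-- The basis dual to `basis` with respect to the metric: `h(e^i, e_j) = δ_ij`. -/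
noncomputable def cobasis (x : M) :
    Module.Basis (Fin d) ℝ (TangentSpace (𝓡 d) x) :=
  (h.bilin x).dualBasis (h.bilin_nondegenerate x) (basis x)

/-- The trace with respect to the metric of a bilinear form on the tangent space at `x`. (It does
not depend on the basis.) -/
noncomputable def tr (x : M) (B : TangentSpace (𝓡 d) x → TangentSpace (𝓡 d) x → ℝ) : ℝ :=
  ∑ i, B (basis x i) (h.cobasis x i)

/-- The Ricci tensor: the trace of the curvature tensor over its first and third arguments. -/
noncomputable def ric (x : M) (u v : TangentSpace (𝓡 d) x) : ℝ :=
  h.tr x fun a b ↦ h.curv4 nab x a u b v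

/-- The Ricci endomorphism, `h(Ric(u), v) = Ric(u, v)`. -/
noncomputable def ricEnd (x : M) (u : TangentSpace (𝓡 d) x) : TangentSpace (𝓡 d) x :=
  ∑ i, h.ric nab x u (basis x i) • h.cobasis x i

/-- Ricci-isotropic: the image of the Ricci endomorphism is totally isotropic. -/
def IsRicciIsotropic : Prop :=
  ∀ (x : M) (u v : TangentSpace (𝓡 d) x), h.val x (h.ricEnd nab x u) (h.ricEnd nab x v) = 0

/-- `X` is a smooth vector field on the open set `U` which is lightlike (nonzero and null) at
every point of `U`. -/
structure IsLightlikeOn (X : Π x : M, TangentSpace (𝓡 d) x) (U : Set M) : Prop where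
  smooth : SmoothFieldOn X U
  ne_zero : ∀ x ∈ U, X x ≠ 0
  null : ∀ x ∈ U, h.val x (X x) (X x) = 0

/-- `X` is parallel on the open set `U`: `∇X = 0` there. -/
def IsParallelOn (X : Π x : M, TangentSpace (𝓡 d) x) (U : Set M) : Prop :=
  ∀ x ∈ U, ∀ u : TangentSpace (𝓡 d) x, nab X x u = 0

/-- The open subset `U`, with the restricted metric, is a pp-wave: it carries a parallel lightlike
vector field, and the trace of `R ⊗ R` over the pairs of arguments `(3,5)` and `(4,6)` vanishes. -/
def IsPPWaveOn (U : Set M) : Prop :=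
  (∃ X : Π x : M, TangentSpace (𝓡 d) x, h.IsLightlikeOn X U ∧ IsParallelOn nab X U) ∧
  ∀ x ∈ U, ∀ y₁ y₂ y₃ y₄ : TangentSpace (𝓡 d) x,
    h.tr x (fun a a' ↦ h.tr x (fun b b' ↦
      h.curv4 nab x y₁ y₂ a b * h.curv4 nab x a' b' y₃ y₄)) = 0

/-- `(M, h)` is a pp-wave. -/
def IsPPWave : Prop := h.IsPPWaveOn nab Set.univ

/-- Every point of `M` has an open neighbourhood which is a pp-wave. -/
def IsLocallyPPWave : Prop :=
  ∀ p : M, ∃ U : Set M, IsOpen U ∧ p ∈ U ∧ h.IsPPWaveOn nab U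

/-- `X` is a recurrent lightlike vector field on `M` with recurrence one-form `Θ`, that is
`∇X = Θ ⊗ X`, and the curvature maps `X^⊥` to `ℝ X`. -/
structure IsPRField (X : Π x : M, TangentSpace (𝓡 d) x)
    (Θ : Π x : M, TangentSpace (𝓡 d) x →L[ℝ] ℝ) : Prop where
  lightlike : h.IsLightlikeOn X Set.univ
  form_smooth : ContMDiff (𝓡 d) ((𝓡 d).prod 𝓘(ℝ, EuclideanSpace ℝ (Fin d) →L[ℝ] ℝ)) ∞
    (fun x ↦ TotalSpace.mk' (EuclideanSpace ℝ (Fin d) →L[ℝ] ℝ) x (Θ x))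
  recurrent : ∀ (x : M) (u : TangentSpace (𝓡 d) x), nab X x u = Θ x u • X x
  curvature : ∀ (x : M) (u v y : TangentSpace (𝓡 d) x), h.val x (X x) y = 0 →
    ∃ c : ℝ, curv nab x u v y = c • X x

/-- `(M, h)` is a pr-wave. -/
def IsPRWave : Prop :=
  ∃ (X : Π x : M, TangentSpace (𝓡 d) x) (Θ : Π x : M, TangentSpace (𝓡 d) x →L[ℝ] ℝ),
    h.IsPRField nab X Θ

end LorentzianMetric

/-- The one-form `Θ` is closed:
`dΘ(V,W) = V(Θ(W)) - W(Θ(V)) - Θ([V,W])` vanishes for all smooth vector fields. -/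
def IsClosedForm (Θ : Π x : M, TangentSpace (𝓡 d) x →L[ℝ] ℝ) : Prop :=
  ∀ V W : Π x : M, TangentSpace (𝓡 d) x, SmoothFieldOn V Set.univ → SmoothFieldOn W Set.univ → ∀ x : M,
    mvfderiv (𝓡 d) (fun y ↦ Θ y (W y)) x (V x) - mvfderiv (𝓡 d) (fun y ↦ Θ y (V y)) x (W x)
      - Θ x (mlieBracket (𝓡 d) V W x) = 0

/-- On the open set `U` the field `X` can be rescaled, by a positive smooth function, to a parallel
field. -/
def CanRescaleToParallelOn (nab : AffineConnection d M) (X : Π x : M, TangentSpace (𝓡 d) x)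
    (U : Set M) : Prop :=
  ∃ f : M → ℝ, ContMDiffOn (𝓡 d) 𝓘(ℝ) ∞ f U ∧ (∀ x ∈ U, 0 < f x) ∧
    LorentzianMetric.IsParallelOn nab (fun x ↦ f x • X x) U

end

/-! Let `x` be the value of the null field at a point, `z` a null vector with `B x z = 1`, and `n =
R z x z`. If every `R u v` maps the orthogonal complement of `x` into the line of `x`, then as a
2-form it is the wedge of `x` with `R u v z`. Together with pair symmetry, this expresses the whole
curvature tensor through the Jacobi operator `R z · z` (`IsCurvatureLike.apply_eq`). Contracting
gives `Ric u = -B x u • n - B n u • x + (s * B x u) • x`, with `s` the trace of the Jacobi operator.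
Isotropy applied to `Ric z` and `Ric x` gives `B n x = 0` and then `B n n = 0`, so `n` is a multiple
of `x`; since `B n z = 0` it vanishes. As `R u v x` is a multiple of `x` whose coefficient is linear
in `n`, the curvature kills `x`. Conversely, if the curvature kills `x` then `n = 0` and the image
of Ricci lies in the null line.

For a recurrent field, `R(V,W)X = dΘ(V,W) X`, so isotropy makes `Θ` closed. A primitive `g` of `Θ`,
local by the Poincaré lemma and global by a covering argument on a simply connected manifold, turns
`X` into the parallel field `exp(-g) X`; the trace condition is again pointwise algebra
(`IsCurvatureLike.trace_eq_zero`).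

For the converse, a parallel field is killed by the curvature. The trace condition then becomes a
vanishing sum of nonnegative squares, which forces each `R u v` to map the orthogonal complement of
`x` into the line of `x` (`IsCurvatureLike.exists_eq_smul_of_trace_eq_zero`), and the algebra above
yields isotropy. -/

/-! ### Pointwise algebra: null vectors, traces and curvature tensors on a Lorentzian vector space.
-/

section LorentzAlgebra

variable {V : Type*} [AddCommGroup V] [Module ℝ V]

/-- A symmetric bilinear form of signature `(-,+,...,+)`. -/
structure LinearMap.BilinForm.IsLorentzian (B : LinearMap.BilinForm ℝ V) : Prop where
  symm : ∀ v w, B v w = B w v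
  index_one : ∃ t, B t t < 0 ∧ ∀ w, B t w = 0 → w ≠ 0 → 0 < B w w

/-- `e` and `e'` are dual frames with respect to the form `B`. -/
structure LinearMap.BilinForm.IsDualFrame {ι : Type*} [Fintype ι] (B : LinearMap.BilinForm ℝ V)
    (e e' : ι → V) : Prop where
  sum_left : ∀ p, ∑ i, B p (e i) • e' i = p
  sum_right : ∀ p, ∑ i, B p (e' i) • e i = p

/-- The symmetries of a curvature endomorphism. -/
structure IsCurvatureLike (B : LinearMap.BilinForm ℝ V) (R : V → V → V → V) : Prop where
  anti_left : ∀ u v w z, B (R u v w) z = -B (R v u w) z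
  anti_right : ∀ u v w z, B (R u v w) z = -B (R u v z) w
  pair : ∀ u v w z, B (R u v w) z = B (R w z u) v

namespace LinearMap.BilinForm.IsLorentzian

variable {B : LinearMap.BilinForm ℝ V} (hB : B.IsLorentzian)
include hB

/-- Subtracting a multiple of `x` moves `y` into the orthogonal complement of a timelike `t`, where
the form is positive definite; since `x` is null and orthogonal to `y`, this does not change `B y
y`. -/
theorem nonneg_of_orthogonal_null {x y : V} (hx : x ≠ 0) (hxx : B x x = 0) (hxy : B x y = 0) :
    0 ≤ B y y ∧ (B y y = 0 → ∃ c : ℝ, y = c • x) := by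
  obtain ⟨t, -, ht⟩ := hB.index_one
  have hxt : B t x ≠ 0 := fun h0 ↦ (ht x h0 hx).ne' hxx
  set c := B t y / B t x
  have h1 : B t (y - c • x) = 0 := by simp [c, hxt]
  have h2 : B (y - c • x) (y - c • x) = B y y := by simp [hxy, hB.symm y x, hxx]
  by_cases h0 : y - c • x = 0
  · have h3 : y = c • x := sub_eq_zero.1 h0
    refine ⟨?_, fun _ ↦ ⟨c, h3⟩⟩
    rw [← h2, h0]; simp
  · have h3 := ht _ h1 h0
    rw [h2] at h3
    exact ⟨h3.le, fun h4 ↦ absurd h4 h3.ne'⟩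

theorem exists_apply_ne_zero {x : V} (hx : x ≠ 0) : ∃ z, B x z ≠ 0 := by
  by_contra! h0
  obtain ⟨t, -, ht⟩ := hB.index_one
  have h1 := ht x (by rw [hB.symm, h0]) hx
  rw [h0 x] at h1
  exact lt_irrefl _ h1

theorem exists_null_conjugate {x : V} (hx : x ≠ 0) (hxx : B x x = 0) :
    ∃ z, B x z = 1 ∧ B z z = 0 := by
  obtain ⟨z, hz⟩ := hB.exists_apply_ne_zero hx
  have h1 : B x ((B x z)⁻¹ • z) = 1 := by simp [hz]
  set z' := (B x z)⁻¹ • z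
  -- Adding a multiple of the null vector `x` keeps the pairing with `x` and shifts the square
  -- linearly, so this multiple makes the square zero.
  refine ⟨z' - (B z' z' / 2) • x, by simp [h1, hxx], ?_⟩
  simp [h1, hxx, hB.symm z' x]
  ring

end LinearMap.BilinForm.IsLorentzian

section Traces

variable {ι : Type*} [Fintype ι] {B : LinearMap.BilinForm ℝ V} {e e' : ι → V}

/-- Contraction rule, with its mirror image below: every trace computation is reduced to these two
sums. -/
theorem LinearMap.BilinForm.IsDualFrame.sum_mul_apply_right (he : B.IsDualFrame e e') (p : V)
    (f : V →ₗ[ℝ] ℝ) : ∑ i, B p (e i) * f (e' i) = f p := by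
  conv_rhs => rw [← he.sum_left p]
  simp

theorem LinearMap.BilinForm.IsDualFrame.sum_mul_apply_left (he : B.IsDualFrame e e') (p : V)
    (f : V →ₗ[ℝ] ℝ) : ∑ i, f (e i) * B p (e' i) = f p := by
  conv_rhs => rw [← he.sum_right p]
  simp [mul_comm]

variable {R : V → V → V → V}

theorem IsCurvatureLike.apply_self (hR : IsCurvatureLike B R) (u v w : V) :
    B (R u v w) w = 0 := by
  have := hR.anti_right u v w w
  linarith

variable {x z : V}

/-- The vector `w - B x w • z` is orthogonal to `x`, so `R u v` sends it to some `c • x`, and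
pairing with `z` identifies `c`. Thus the 2-form of `R u v` is a wedge with `x`. -/
theorem IsCurvatureLike.apply_eq_wedge (hR : IsCurvatureLike B R) (hxz : B x z = 1)
    (hx : ∀ u v y, B x y = 0 → ∃ c : ℝ, R u v y = c • x) (u v w y : V) :
    B (R u v w) y = B x w * B (R u v z) y - B (R u v z) w * B x y := by
  obtain ⟨c, hc⟩ := hx u v (w - B x w • z) (by simp [hxz])
  have h1 : B (R u v (w - B x w • z)) z = -(B (R u v z) w) := by
    rw [hR.anti_right]; simp [hR.apply_self]
  have h2 : c = -(B (R u v z) w) := by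
    rw [← h1, hc]; simp [hxz]
  have h3 : B (R u v (w - B x w • z)) y = c * B x y := by rw [hc]; simp
  rw [hR.anti_right, map_sub, map_smul, smul_eq_mul, hR.anti_right u v y w,
    hR.anti_right u v y z, h2] at h3
  linarith

/-- The normal form of a curvature tensor mapping the orthogonal complement of the null vector `x`
into the line spanned by `x`. -/
theorem IsCurvatureLike.apply_eq (hR : IsCurvatureLike B R) (hxz : B x z = 1)
    (hx : ∀ u v y, B x y = 0 → ∃ c : ℝ, R u v y = c • x) (u v w y : V) :
    B (R u v w) y = B x w * (B x u * B (R z y z) v - B (R z y z) u * B x v)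
      - (B x u * B (R z w z) v - B (R z w z) u * B x v) * B x y := by
  -- Pair symmetry exchanges the two 2-form slots, so the wedge formula can be used a second time,
  -- in `u` and `v`.
  rw [hR.apply_eq_wedge hxz hx u v w y, hR.pair u v z y, hR.pair u v z w,
    hR.apply_eq_wedge hxz hx z y u v, hR.apply_eq_wedge hxz hx z w u v]

/-- The Jacobi operator `R(z, ·)z` is symmetric. -/
theorem IsCurvatureLike.symm_jacobi (hR : IsCurvatureLike B R) (v w : V) :
    B (R z v z) w = B (R z w z) v := hR.pair z v z w

theorem IsCurvatureLike.apply_null_eq (hR : IsCurvatureLike B R)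
    (hxx : B x x = 0) (hxz : B x z = 1)
    (hx : ∀ u v y, B x y = 0 → ∃ c : ℝ, R u v y = c • x) (u v : V) :
    R u v x = (B (R z x z) u * B x v - B x u * B (R z x z) v) • x := by
  obtain ⟨c, hc⟩ := hx u v x hxx
  have := hR.apply_eq hxz hx u v x z
  rw [hc] at this ⊢
  simp only [map_smul, LinearMap.smul_apply, hxz, hxx, smul_eq_mul] at this
  congr 1
  linarith

/-- In the contracted normal form, the product of two `B x` factors gives `B x x = 0`, the mixed
products evaluate the Jacobi operator against `x`, and its trace survives. -/
theorem IsCurvatureLike.ricci_eq (hR : IsCurvatureLike B R)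
    (he : B.IsDualFrame e e') (hxx : B x x = 0) (hxz : B x z = 1)
    (hx : ∀ u v y, B x y = 0 → ∃ c : ℝ, R u v y = c • x) (u v : V) :
    ∑ i, B (R (e i) u (e' i)) v =
      -(B (R z x z) v * B x u) - B x v * B (R z x z) u
        + (∑ i, B (R z (e i) z) (e' i)) * (B x u * B x v) := by
  have h1 := he.sum_mul_apply_right x (B x)
  have h2 := he.sum_mul_apply_left x (B (R z v z))
  have h3 := he.sum_mul_apply_right x (B (R z u z))
  rw [hxx] at h1
  calc ∑ i, B (R (e i) u (e' i)) v
      = ∑ i, ((B x (e i) * B x (e' i)) * B (R z v z) u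
          - (B (R z v z) (e i) * B x (e' i)) * B x u
          - (B x (e i) * B (R z u z) (e' i)) * B x v
          + B (R z (e i) z) (e' i) * (B x u * B x v)) := by
        refine Finset.sum_congr rfl fun i _ ↦ ?_
        rw [hR.apply_eq hxz hx (e i) u (e' i) v, hR.symm_jacobi (e' i) u,
          hR.symm_jacobi (e' i) (e i)]
        ring
    _ = _ := by
        simp only [Finset.sum_add_distrib, Finset.sum_sub_distrib, ← Finset.sum_mul]
        rw [h1, h2, h3, hR.symm_jacobi v x, hR.symm_jacobi u x]
        ring

theorem IsCurvatureLike.ricciEnd_eq (hR : IsCurvatureLike B R)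
    (he : B.IsDualFrame e e') (hxx : B x x = 0) (hxz : B x z = 1)
    (hx : ∀ u v y, B x y = 0 → ∃ c : ℝ, R u v y = c • x) (u : V) :
    ∑ j, (∑ i, B (R (e i) u (e' i)) (e j)) • e' j =
      -(B x u • R z x z) - B (R z x z) u • x
        + ((∑ i, B (R z (e i) z) (e' i)) * B x u) • x := by
  set s := ∑ i, B (R z (e i) z) (e' i)
  set T := -(B x u • R z x z) - B (R z x z) u • x + (s * B x u) • x
  conv_rhs => rw [← he.sum_left T]
  refine Finset.sum_congr rfl fun j _ ↦ ?_
  rw [hR.ricci_eq he hxx hxz hx]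
  congr 1
  simp only [T, map_add, map_sub, map_neg, map_smul, LinearMap.add_apply, LinearMap.sub_apply,
    LinearMap.neg_apply, LinearMap.smul_apply, smul_eq_mul]
  ring

/-- If the Ricci endomorphism has isotropic image, then `x` is annihilated by the curvature. -/
theorem IsCurvatureLike.apply_null_eq_zero_of_isotropic (hR : IsCurvatureLike B R)
    (hB : B.IsLorentzian) (he : B.IsDualFrame e e') (hx0 : x ≠ 0) (hxx : B x x = 0)
    (hx : ∀ u v y, B x y = 0 → ∃ c : ℝ, R u v y = c • x)
    (hiso : ∀ u v, B (∑ j, (∑ i, B (R (e i) u (e' i)) (e j)) • e' j)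
      (∑ j, (∑ i, B (R (e i) v (e' i)) (e j)) • e' j) = 0) (u v : V) :
    R u v x = 0 := by
  obtain ⟨z, hxz, hzz⟩ := hB.exists_null_conjugate hx0 hxx
  simp only [hR.ricciEnd_eq he hxx hxz hx] at hiso
  set s := ∑ i, B (R z (e i) z) (e' i)
  set n := R z x z with hn
  have hnz : B n z = 0 := hR.apply_self _ _ _
  have hsx : B n x = B x n := hB.symm _ _
  -- `Ric x` is `-B n x • x`, and its pairing with `Ric z` is the square of `B n x`.
  have h1 := hiso z x
  simp only [map_add, map_sub, map_neg, map_smul, LinearMap.add_apply, LinearMap.sub_apply,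
    LinearMap.neg_apply, LinearMap.smul_apply, smul_eq_mul, hxx, hxz, hnz, ← hsx] at h1
  have hnx : B n x = 0 := by
    have : B n x * B n x = 0 := by linarith
    simpa using this
  -- Now that `B n x = 0`, the square of `Ric z = -n + s • x` is just `B n n`.
  have h2 := hiso z z
  simp only [map_add, map_sub, map_neg, map_smul, LinearMap.add_apply, LinearMap.sub_apply,
    LinearMap.neg_apply, LinearMap.smul_apply, smul_eq_mul, hxx, hxz, hnz, ← hsx, hnx] at h2
  obtain ⟨c, hc⟩ := (hB.nonneg_of_orthogonal_null hx0 hxx (hsx ▸ hnx)).2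
    (show B n n = 0 by linarith)
  have hc0 : c = 0 := by
    rw [hc] at hnz
    simpa [hxz] using hnz
  have hn0 : n = 0 := by rw [hc, hc0, zero_smul]
  rw [hR.apply_null_eq hxx hxz hx, ← hn, hn0]
  simp

/-- If the curvature annihilates `x`, then the Ricci endomorphism has isotropic image. -/
theorem IsCurvatureLike.isotropic_of_apply_null_eq_zero (hR : IsCurvatureLike B R)
    (hB : B.IsLorentzian) (he : B.IsDualFrame e e') (hx0 : x ≠ 0) (hxx : B x x = 0)
    (hx : ∀ u v y, B x y = 0 → ∃ c : ℝ, R u v y = c • x) (hRx : ∀ u v, R u v x = 0) (u v : V) :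
    B (∑ j, (∑ i, B (R (e i) u (e' i)) (e j)) • e' j)
      (∑ j, (∑ i, B (R (e i) v (e' i)) (e j)) • e' j) = 0 := by
  obtain ⟨z, hxz, hzz⟩ := hB.exists_null_conjugate hx0 hxx
  simp only [hR.ricciEnd_eq he hxx hxz hx]
  -- The Jacobi operator is symmetric and its values are orthogonal to `x`, so it vanishes at `x`;
  -- only the `x`-valued trace term of Ricci remains.
  have hn (w : V) : B (R z x z) w = 0 := by
    rw [hR.symm_jacobi, hR.anti_right, hRx]; simp
  have hn' (w : V) : B w (R z x z) = 0 := by rw [hB.symm, hn]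
  simp [hn, hn', hxx]

/-- Both factors are wedges of `x` with a vector orthogonal to `x`. Each of the four terms of their
contraction therefore contains `B x x` or a product of `x` with one of these vectors. -/
theorem IsCurvatureLike.trace_eq_zero (hR : IsCurvatureLike B R)
    (hB : B.IsLorentzian) (he : B.IsDualFrame e e') (hx0 : x ≠ 0) (hxx : B x x = 0)
    (hx : ∀ u v y, B x y = 0 → ∃ c : ℝ, R u v y = c • x) (hRx : ∀ u v, R u v x = 0)
    (y₁ y₂ y₃ y₄ : V) :
    ∑ i, ∑ j, B (R y₁ y₂ (e i)) (e j) * B (R (e' i) (e' j) y₃) y₄ = 0 := by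
  obtain ⟨z, hxz, hzz⟩ := hB.exists_null_conjugate hx0 hxx
  have hnx (u v : V) : B (R u v z) x = 0 := by
    rw [hR.anti_right, hRx]; simp
  have hnx' (u v : V) : B x (R u v z) = 0 := by rw [hB.symm, hnx]
  have key (i j) : B (R y₁ y₂ (e i)) (e j) * B (R (e' i) (e' j) y₃) y₄ =
      B x (e i) * B x (e' i) * (B (R y₁ y₂ z) (e j) * B (R y₃ y₄ z) (e' j))
      - B x (e i) * B (R y₃ y₄ z) (e' i) * (B (R y₁ y₂ z) (e j) * B x (e' j))
      - B (R y₁ y₂ z) (e i) * B x (e' i) * (B x (e j) * B (R y₃ y₄ z) (e' j))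
      + B (R y₁ y₂ z) (e i) * B (R y₃ y₄ z) (e' i) * (B x (e j) * B x (e' j)) := by
    rw [hR.pair (e' i), hR.apply_eq_wedge hxz hx y₁ y₂,
      hR.apply_eq_wedge hxz hx y₃ y₄]
    ring
  simp only [key, Finset.sum_add_distrib, Finset.sum_sub_distrib, ← Finset.mul_sum]
  rw [he.sum_mul_apply_right x (B x), he.sum_mul_apply_right x (B (R y₃ y₄ z)),
    he.sum_mul_apply_left x (B (R y₁ y₂ z)), hnx, hnx, hxx]
  simp only [mul_zero, Finset.sum_const_zero, sub_zero, add_zero, ← Finset.sum_mul]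
  rw [he.sum_mul_apply_right x (B x), hxx, zero_mul]

/-- The form is positive definite on the common orthogonal complement of `x` and `z`: a null vector
there would be a multiple of `x`, and its pairing with `z` excludes this unless it is zero. The
weights `l` are the inverse squares of an orthogonal basis, which need not be normalised. -/
theorem LinearMap.BilinForm.IsLorentzian.exists_orthogonal_frame [FiniteDimensional ℝ V]
    (hB : B.IsLorentzian) (hx0 : x ≠ 0) (hxx : B x x = 0) (hzz : B z z = 0) (hxz : B x z = 1) :
    ∃ (n : ℕ) (w : Fin n → V) (l : Fin n → ℝ), (∀ j, 0 < l j) ∧ (∀ j, B x (w j) = 0) ∧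
      ∀ b, b = B x b • z + B z b • x + ∑ j, (l j * B b (w j)) • w j := by
  set W : Submodule ℝ V := LinearMap.ker (B x) ⊓ LinearMap.ker (B z)
  have hW (w : W) : B x w = 0 ∧ B z w = 0 := w.2
  have hpos (w : W) (hw : w ≠ 0) : 0 < B w w := by
    obtain ⟨h1, h2⟩ := hB.nonneg_of_orthogonal_null hx0 hxx (hW w).1
    refine lt_of_le_of_ne h1 fun h3 ↦ hw ?_
    obtain ⟨c, hc⟩ := h2 h3.symm
    have h4 := (hW w).2
    rw [hc, map_smul, hB.symm, hxz] at h4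
    have hc0 : c = 0 := by simpa using h4
    rw [hc0, zero_smul] at hc
    exact_mod_cast hc
  obtain ⟨w, hw⟩ := LinearMap.BilinForm.exists_orthogonal_basis (B := B.restrict W)
    ⟨fun v w ↦ hB.symm _ _⟩
  have hl (j) : 0 < B (w j) (w j) := hpos _ (w.ne_zero j)
  refine ⟨_, fun j ↦ w j, fun j ↦ (B (w j) (w j))⁻¹, fun j ↦ inv_pos.2 (hl j),
    fun j ↦ (hW _).1, fun b ↦ ?_⟩
  have hb : b - B x b • z - B z b • x ∈ W := by
    refine ⟨?_, ?_⟩ <;> simp [hxz, hxx, hzz, hB.symm z x]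
  have key := w.sum_repr ⟨_, hb⟩
  have hcoef (j) : w.repr ⟨_, hb⟩ j = (B (w j) (w j))⁻¹ * B b (w j) := by
    have h1 : B (b - B x b • z - B z b • x) (w j) = w.repr ⟨_, hb⟩ j * B (w j) (w j) := by
      have h2 := congrArg (fun y : W ↦ B y (w j)) key
      simp only [Submodule.coe_sum, Submodule.coe_smul, map_sum, map_smul, LinearMap.sum_apply,
        LinearMap.smul_apply, smul_eq_mul] at h2
      rw [← h2, Finset.sum_eq_single j]
      · intro k _ hk
        have h3 : B (w k) (w j) = 0 := hw hk
        rw [h3, mul_zero]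
      · simp
    simp only [map_sub, map_smul, LinearMap.sub_apply, LinearMap.smul_apply, (hW _).1, (hW _).2,
      smul_zero, sub_zero] at h1
    rw [h1]
    field_simp [(hl j).ne']
  have h5 := congrArg (fun y : W ↦ (y : V)) key
  simp only [Submodule.coe_sum, Submodule.coe_smul, hcoef] at h5
  rw [h5]
  abel

/-- If the curvature annihilates `x` and the trace of `R ⊗ R` over the last two pairs vanishes,
then the curvature maps the orthogonal complement of `x` into the line spanned by `x`. -/
theorem IsCurvatureLike.exists_eq_smul_of_trace_eq_zero [FiniteDimensional ℝ V]
    (hR : IsCurvatureLike B R)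
    (hB : B.IsLorentzian) (he : B.IsDualFrame e e') (hx0 : x ≠ 0) (hxx : B x x = 0)
    (hRx : ∀ u v, R u v x = 0)
    (htr : ∀ y₁ y₂ y₃ y₄ : V,
      ∑ i, ∑ j, B (R y₁ y₂ (e i)) (e j) * B (R (e' i) (e' j) y₃) y₄ = 0) (u v y : V)
    (hy : B x y = 0) : ∃ c : ℝ, R u v y = c • x := by
  obtain ⟨z, hxz, hzz⟩ := hB.exists_null_conjugate hx0 hxx
  have hnd {p q : V} (h : ∀ r, B p r = B q r) : p = q := by
    rw [← he.sum_left p, ← he.sum_left q]; simp [h]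
  -- Linearity of `R u v` is not part of `IsCurvatureLike`; it follows from skew symmetry, which
  -- moves the argument into a slot of `B`.
  have hlin (a b : V) (c : ℝ) : R u v (c • a + b) = c • R u v a + R u v b := hnd fun r ↦ by
    rw [hR.anti_right]
    simp only [map_add, map_smul, LinearMap.add_apply, LinearMap.smul_apply, hR.anti_right u v _ r]
    simp only [smul_eq_mul]; ring
  let A : V →ₗ[ℝ] V :=
    { toFun := R u v
      map_add' := fun a b ↦ by simpa using hlin a b 1
      map_smul' := fun c a ↦ by
        -- With scalar `-1` and both vectors zero, the right side of `hlin` is `-R u v 0 + R u v 0`.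
        have h0 : R u v 0 = 0 := by simpa using hlin 0 0 (-1)
        simpa [h0] using hlin a 0 c }
  have hA (a) : A a = R u v a := rfl
  have hAx : A x = 0 := hRx u v
  have hxA (a) : B x (A a) = 0 := by
    rw [hB.symm, hA, hR.anti_right, hRx]; simp
  obtain ⟨n, w, l, hl, hw, hres⟩ := hB.exists_orthogonal_frame hx0 hxx hzz hxz
  -- Taking the same pair `u`, `v` in both factors makes the double trace the squared norm of `A`.
  have hQ : ∑ i, B (A (e i)) (A (e' i)) = 0 := by
    rw [← htr u v u v]
    refine Finset.sum_congr rfl fun i _ ↦ ?_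
    simp only [hR.pair (e' i)]
    rw [he.sum_mul_apply_right (R u v (e i)) (B (R u v (e' i))), hB.symm]; rfl
  -- Only the spacelike part of the frame contributes: `A` kills the `x` component, and the `z`
  -- component contracts to `A x = 0`.
  have hQ' : ∑ j, l j * B (A (w j)) (A (w j)) = 0 := by
    rw [← hQ]
    have h1 (i) : B (A (e i)) (A (e' i)) = B x (e' i) * B (A (e i)) (A z)
        + ∑ j, l j * (B (A (e i)) (A (w j)) * B (w j) (e' i)) := by
      conv_lhs => rw [hres (e' i)]
      simp only [map_add, map_smul, map_sum, hAx, smul_zero, add_zero, smul_eq_mul]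
      congr 1
      refine Finset.sum_congr rfl fun j _ ↦ ?_
      rw [hB.symm (w j)]; ring
    simp only [h1, Finset.sum_add_distrib]
    have h2 : ∑ i, B x (e' i) * B (A (e i)) (A z) = 0 := by
      have := he.sum_mul_apply_left x ((B.flip (A z)).comp A)
      simp only [LinearMap.comp_apply, hAx, map_zero] at this
      rw [← this]
      exact Finset.sum_congr rfl fun i _ ↦ mul_comm _ _
    rw [h2, zero_add, Finset.sum_comm]
    refine Finset.sum_congr rfl fun j _ ↦ ?_
    rw [← Finset.mul_sum]
    congr 1
    exact (he.sum_mul_apply_left (w j) ((B.flip (A (w j))).comp A)).symm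
  have hnn (j) : 0 ≤ B (A (w j)) (A (w j)) := (hB.nonneg_of_orthogonal_null hx0 hxx (hxA _)).1
  -- The values of `A` are orthogonal to `x`, so each summand is nonnegative; all vanish, and a null
  -- vector orthogonal to `x` is a multiple of `x`.
  have hz (j) : ∃ c : ℝ, A (w j) = c • x := by
    have h1 := (Finset.sum_eq_zero_iff_of_nonneg fun j _ ↦ mul_nonneg (hl j).le (hnn j)).1 hQ' j
      (Finset.mem_univ j)
    exact (hB.nonneg_of_orthogonal_null hx0 hxx (hxA _)).2
      ((mul_eq_zero.1 h1).resolve_left (hl j).ne')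
  choose c hc using hz
  refine ⟨∑ j, l j * B y (w j) * c j, ?_⟩
  rw [← hA]
  conv_lhs => rw [hres y, hy]
  simp [hAx, hc, Finset.sum_smul, smul_smul]

end Traces

end LorentzAlgebra

/-! ### Calculus of vector fields smooth near a point: connection, Lie bracket, commutators. -/

section SmoothFields

variable {d : ℕ} {M : Type*} [TopologicalSpace M]
  [ChartedSpace (EuclideanSpace ℝ (Fin d)) M] [IsManifold (𝓡 d) ∞ M]

/-- The vector field `X` is smooth on a neighbourhood of `x`. -/
def SmoothFieldNear (X : Π x : M, TangentSpace (𝓡 d) x) (x : M) : Prop :=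
  ∀ᶠ y in 𝓝 x, ContMDiffAt (𝓡 d) ((𝓡 d).prod 𝓘(ℝ, EuclideanSpace ℝ (Fin d))) ∞
    (fun y ↦ (⟨y, X y⟩ : TangentBundle (𝓡 d) M)) y

variable {X Y Z : Π x : M, TangentSpace (𝓡 d) x} {x : M}

namespace SmoothFieldNear

theorem eventually (hX : SmoothFieldNear X x) : ∀ᶠ y in 𝓝 x, SmoothFieldNear X y :=
  eventually_eventually_nhds.2 hX

theorem contMDiffAt (hX : SmoothFieldNear X x) :
    ContMDiffAt (𝓡 d) ((𝓡 d).prod 𝓘(ℝ, EuclideanSpace ℝ (Fin d))) ∞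
      (fun y ↦ (⟨y, X y⟩ : TangentBundle (𝓡 d) M)) x :=
  hX.self_of_nhds

theorem diffFieldAt (hX : SmoothFieldNear X x) : DiffFieldAt X x :=
  hX.contMDiffAt.mdifferentiableAt (by simp)

theorem sub (hX : SmoothFieldNear X x) (hY : SmoothFieldNear Y x) : SmoothFieldNear (X - Y) x := by
  filter_upwards [hX, hY] with y h1 h2 using h1.sub_section h2

theorem extend (v : TangentSpace (𝓡 d) x) :
    SmoothFieldNear (FiberBundle.extend (EuclideanSpace ℝ (Fin d)) v) x := by
  obtain ⟨s, hs, h⟩ := exists_contMDiffOn_extend (𝓡 d) (EuclideanSpace ℝ (Fin d)) (k := ∞) v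
  filter_upwards [eventually_mem_nhds_iff.2 hs] with y hy using h.contMDiffAt hy

theorem congr (hX : SmoothFieldNear X x) (h : Y =ᶠ[𝓝 x] X) : SmoothFieldNear Y x := by
  filter_upwards [hX, h.eventuallyEq_nhds] with y h1 h2
  refine h1.congr_of_eventuallyEq ?_
  filter_upwards [h2] with w hw
  rw [hw]

/-- Multiplication by a bump function supported where `X` is smooth. This reduces statements about
germs to smoothness of the connection on global fields. -/
theorem exists_global [T2Space M] (hX : SmoothFieldNear X x) :
    ∃ X' : Π x : M, TangentSpace (𝓡 d) x, SmoothFieldOn X' Set.univ ∧ X' =ᶠ[𝓝 x] X := by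
  obtain ⟨U, hU, hUo, hxU⟩ := eventually_nhds_iff.1 hX
  obtain ⟨f, -, hf⟩ := (SmoothBumpFunction.nhds_basis_tsupport (I := 𝓡 d) x).mem_iff.1
    (hUo.mem_nhds hxU)
  refine ⟨(f : M → ℝ) • X, ?_, ?_⟩
  · exact (ContMDiffOn.smul_section_of_tsupport (f.contMDiff.contMDiffOn) hUo hf
      fun y hy ↦ (hU y hy).contMDiffWithinAt).contMDiffOn
  · filter_upwards [f.eventuallyEq_one] with y hy
    simp only [Pi.smul_apply', hy, Pi.one_apply, one_smul]
    rfl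

end SmoothFieldNear

theorem SmoothFieldOn.near {U : Set M} (hX : SmoothFieldOn X U) (hU : IsOpen U) (hx : x ∈ U) :
    SmoothFieldNear X x := by
  filter_upwards [hU.mem_nhds hx] with y hy using hX.contMDiffAt (hU.mem_nhds hy)

theorem eventually_contMDiffAt_form_apply {Θ : Π x : M, TangentSpace (𝓡 d) x →L[ℝ] ℝ}
    (hΘ : ContMDiff (𝓡 d) ((𝓡 d).prod 𝓘(ℝ, EuclideanSpace ℝ (Fin d) →L[ℝ] ℝ)) ∞
      (fun x ↦ TotalSpace.mk' (EuclideanSpace ℝ (Fin d) →L[ℝ] ℝ) x (Θ x)))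
    (hX : SmoothFieldNear X x) :
    ∀ᶠ y in 𝓝 x, ContMDiffAt (𝓡 d) 𝓘(ℝ) ∞ (fun y ↦ Θ y (X y)) y := by
  filter_upwards [hX] with y h1
  have := ContMDiffAt.clm_bundle_apply (E₂ := fun _ : M ↦ ℝ) (F₂ := ℝ) (hΘ y) h1
  exact ((contMDiffAt_section _).1 this :)

theorem LorentzianMetric.eventually_contMDiffAt_apply (h : LorentzianMetric d M)
    (hX : SmoothFieldNear X x) (hY : SmoothFieldNear Y x) :
    ∀ᶠ y in 𝓝 x, ContMDiffAt (𝓡 d) 𝓘(ℝ) ∞ (fun y ↦ h.val y (X y) (Y y)) y := by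
  filter_upwards [hX, hY] with y h1 h2
  have := ContMDiffAt.clm_bundle_apply₂ (E₃ := fun _ : M ↦ ℝ) (F₃ := ℝ) (h.contMDiff y) h1 h2
  exact ((contMDiffAt_section _).1 this :)

section Connection

variable {nab : AffineConnection d M}

theorem AffineConnection.congr (nab : AffineConnection d M) (hX : DiffFieldAt X x)
    (hY : DiffFieldAt Y x) (h : X =ᶠ[𝓝 x] Y) : nab X x = nab Y x :=
  nab.isCovariantDerivativeOnUniv.congr_of_eventuallyEq hX hY Filter.univ_mem h

theorem SmoothFieldNear.nab_apply [T2Space M] (hnab : nab.ContMDiffCovariantDerivative ∞)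
    (hX : SmoothFieldNear X x) (hY : SmoothFieldNear Y x) :
    SmoothFieldNear (fun y ↦ nab X y (Y y)) x := by
  obtain ⟨X', hX', hXX'⟩ := hX.exists_global
  have h1 := hnab.contMDiff.contMDiff (σ := X') hX'
  have h2 : SmoothFieldNear (fun y ↦ nab X' y (Y y)) x := by
    filter_upwards [hY] with y hy
    exact ContMDiffAt.clm_bundle_apply (h1.contMDiffAt Filter.univ_mem) hy
  refine h2.congr ?_
  filter_upwards [hXX'.eventuallyEq_nhds, hX.eventually] with y hy hy'
  rw [nab.congr hy'.diffFieldAt (hX'.near isOpen_univ (Set.mem_univ y)).diffFieldAt hy.symm]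

theorem isManifold_minSmoothness (n : ℕ) : IsManifold (𝓡 d) (minSmoothness ℝ n) M := by
  rw [minSmoothness_of_isRCLikeNormedField]
  exact IsManifold.of_le (n := ∞) (by exact_mod_cast le_top)

theorem SmoothFieldNear.mlieBracket (hX : SmoothFieldNear X x) (hY : SmoothFieldNear Y x) :
    SmoothFieldNear (mlieBracket (𝓡 d) X Y) x := by
  have : IsManifold (𝓡 d) (minSmoothness ℝ 2) M := isManifold_minSmoothness 2
  have : IsManifold (𝓡 d) (((⊤ : ℕ∞) : WithTop ℕ∞) + 1) M := ‹IsManifold (𝓡 d) ∞ M›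
  filter_upwards [hX, hY] with y h1 h2
  exact ContMDiffAt.mlieBracket_vectorField (m := ⊤) (n := ⊤) h1 h2 (by simp)

theorem SmoothFieldNear.jacobi (hX : SmoothFieldNear X x) (hY : SmoothFieldNear Y x)
    (hZ : SmoothFieldNear Z x) :
    VectorField.mlieBracket (𝓡 d) X (VectorField.mlieBracket (𝓡 d) Y Z) x =
      VectorField.mlieBracket (𝓡 d) (VectorField.mlieBracket (𝓡 d) X Y) Z x +
      VectorField.mlieBracket (𝓡 d) Y (VectorField.mlieBracket (𝓡 d) X Z) x := by
  have : IsManifold (𝓡 d) (minSmoothness ℝ 3) M := isManifold_minSmoothness 3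
  have h2 : minSmoothness ℝ 2 ≤ ∞ := by
    rw [minSmoothness_of_isRCLikeNormedField]; exact WithTop.coe_le_coe.2 (le_top : (2 : ℕ∞) ≤ ⊤)
  exact leibniz_identity_mlieBracket_apply (hX.contMDiffAt.of_le h2) (hY.contMDiffAt.of_le h2)
    (hZ.contMDiffAt.of_le h2)

theorem SmoothFieldNear.smul {g : M → ℝ} (hX : SmoothFieldNear X x)
    (hg : ∀ᶠ y in 𝓝 x, ContMDiffAt (𝓡 d) 𝓘(ℝ) ∞ g y) : SmoothFieldNear (g • X) x := by
  filter_upwards [hX, hg] with y h1 h2 using h2.smul_section h1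

theorem SmoothFieldNear.mlieBracket_smul {g : M → ℝ}
    (hY : DiffFieldAt Y x) (hg : MDifferentiableAt (𝓡 d) 𝓘(ℝ) g x) :
    VectorField.mlieBracket (𝓡 d) X (g • Y) x =
      mvfderiv (𝓡 d) g x (X x) • Y x + g x • VectorField.mlieBracket (𝓡 d) X Y x := by
  have : IsManifold (𝓡 d) (minSmoothness ℝ 2) M := isManifold_minSmoothness 2
  exact mlieBracket_smul_right hg hY

/-- Leibniz rule applied twice. The two middle terms are exchanged by swapping `X` and `Y`, so they
cancel in the commutator. -/
theorem mlieBracket_mlieBracket_smul {g : M → ℝ}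
    (hY : SmoothFieldNear Y x) (hZ : SmoothFieldNear Z x)
    (hg : ∀ᶠ y in 𝓝 x, ContMDiffAt (𝓡 d) 𝓘(ℝ) ∞ g y)
    (hYg : MDifferentiableAt (𝓡 d) 𝓘(ℝ) (fun y ↦ mvfderiv (𝓡 d) g y (Y y)) x) :
    mlieBracket (𝓡 d) X (mlieBracket (𝓡 d) Y (g • Z)) x =
      mvfderiv (𝓡 d) (fun y ↦ mvfderiv (𝓡 d) g y (Y y)) x (X x) • Z x
      + mvfderiv (𝓡 d) g x (Y x) • mlieBracket (𝓡 d) X Z x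
      + mvfderiv (𝓡 d) g x (X x) • mlieBracket (𝓡 d) Y Z x
      + g x • mlieBracket (𝓡 d) X (mlieBracket (𝓡 d) Y Z) x := by
  have : IsManifold (𝓡 d) (minSmoothness ℝ 2) M := isManifold_minSmoothness 2
  have hg' (y) (h : ContMDiffAt (𝓡 d) 𝓘(ℝ) ∞ g y) : MDifferentiableAt (𝓡 d) 𝓘(ℝ) g y :=
    h.mdifferentiableAt (by simp)
  have h1 : mlieBracket (𝓡 d) Y (g • Z) =ᶠ[𝓝 x]
      (fun y ↦ mvfderiv (𝓡 d) g y (Y y)) • Z + g • mlieBracket (𝓡 d) Y Z := by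
    filter_upwards [hZ.eventually, hg] with y h2 h3
    rw [SmoothFieldNear.mlieBracket_smul h2.diffFieldAt (hg' y h3)]
    rfl
  have hgx := hg' x hg.self_of_nhds
  have hYZ := (hY.mlieBracket hZ).diffFieldAt
  rw [(Filter.EventuallyEq.refl (𝓝 x) X).mlieBracket_vectorField_eq h1,
    mlieBracket_add_right (hYg.smul_section hZ.diffFieldAt) (hgx.smul_section hYZ),
    SmoothFieldNear.mlieBracket_smul hZ.diffFieldAt hYg,
    SmoothFieldNear.mlieBracket_smul hYZ hgx]
  module

/-- The commutator of directional derivatives is the derivative along the Lie bracket. -/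
theorem mvfderiv_commutator {g : M → ℝ} (hX : SmoothFieldNear X x) (hY : SmoothFieldNear Y x)
    (hg : ∀ᶠ y in 𝓝 x, ContMDiffAt (𝓡 d) 𝓘(ℝ) ∞ g y)
    (hXg : MDifferentiableAt (𝓡 d) 𝓘(ℝ) (fun y ↦ mvfderiv (𝓡 d) g y (X y)) x)
    (hYg : MDifferentiableAt (𝓡 d) 𝓘(ℝ) (fun y ↦ mvfderiv (𝓡 d) g y (Y y)) x) :
    mvfderiv (𝓡 d) (fun y ↦ mvfderiv (𝓡 d) g y (Y y)) x (X x)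
      - mvfderiv (𝓡 d) (fun y ↦ mvfderiv (𝓡 d) g y (X y)) x (Y x)
      = mvfderiv (𝓡 d) g x (mlieBracket (𝓡 d) X Y x) := by
  by_cases hw : ∃ w : TangentSpace (𝓡 d) x, w ≠ 0
  · obtain ⟨w, hw⟩ := hw
    have hW := SmoothFieldNear.extend w
    set W := FiberBundle.extend (EuclideanSpace ℝ (Fin d)) w
    have hWx : W x = w := extend_apply_self _ w
    -- The Jacobi identity for `X`, `Y`, `g • W`, minus `g` times the one for `X`, `Y`, `W`, leaves
    -- the desired scalar identity times `W`; hence the need for `w ≠ 0`.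
    have h1 := hX.jacobi hY (hW.smul hg)
    rw [mlieBracket_mlieBracket_smul hY hW hg hYg,
      mlieBracket_mlieBracket_smul hX hW hg hXg,
      SmoothFieldNear.mlieBracket_smul hW.diffFieldAt
        (hg.self_of_nhds.mdifferentiableAt (by simp)), hX.jacobi hY hW, hWx] at h1
    have h2 : (mvfderiv (𝓡 d) (fun y ↦ mvfderiv (𝓡 d) g y (Y y)) x (X x)
      - mvfderiv (𝓡 d) (fun y ↦ mvfderiv (𝓡 d) g y (X y)) x (Y x)
      - mvfderiv (𝓡 d) g x (mlieBracket (𝓡 d) X Y x)) • w = 0 := by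
      rw [← sub_eq_zero] at h1
      rw [← h1]
      module
    exact sub_eq_zero.1 ((smul_eq_zero.1 h2).resolve_right hw)
  -- If the tangent space is zero, both sides are derivatives along the zero vector.
  · push Not at hw
    rw [hw (X x), hw (Y x), hw (mlieBracket (𝓡 d) X Y x)]
    simp

end Connection

end SmoothFields

/-! ### Symmetries and tensoriality of the Levi-Civita curvature. -/

section Curvature

variable {d : ℕ} {M : Type*} [TopologicalSpace M]
  [ChartedSpace (EuclideanSpace ℝ (Fin d)) M]

theorem Filter.EventuallyEq.mvfderiv_eq {f g : M → ℝ} {x : M} (hfg : f =ᶠ[𝓝 x] g) :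
    mvfderiv (𝓡 d) f x = mvfderiv (𝓡 d) g x := by
  ext v
  exact congrArg (fun L : TangentSpace (𝓡 d) x →L[ℝ] ℝ ↦ L v) hfg.mfderiv_eq

variable [IsManifold (𝓡 d) ∞ M]
  {h : LorentzianMetric d M} {nab : AffineConnection d M}
  {X Y U V W Z : Π x : M, TangentSpace (𝓡 d) x} {x : M}

theorem AffineConnection.apply_add (nab : AffineConnection d M)
    (hX : DiffFieldAt X x) (hY : DiffFieldAt Y x) : nab (X + Y) x = nab X x + nab Y x :=
  nab.isCovariantDerivativeOnUniv.add hX hY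

theorem AffineConnection.apply_sub (nab : AffineConnection d M)
    (hX : SmoothFieldNear X x) (hY : SmoothFieldNear Y x) : nab (X - Y) x = nab X x - nab Y x := by
  rw [eq_sub_iff_add_eq, ← nab.apply_add (hX.sub hY).diffFieldAt hY.diffFieldAt, sub_add_cancel]

theorem AffineConnection.apply_smul (nab : AffineConnection d M) {f : M → ℝ}
    (hf : MDifferentiableAt (𝓡 d) 𝓘(ℝ) f x) (hX : DiffFieldAt X x) (u : TangentSpace (𝓡 d) x) :
    nab (fun y ↦ f y • X y) x u = f x • nab X x u + mvfderiv (𝓡 d) f x u • X x := by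
  have := nab.isCovariantDerivativeOnUniv.leibniz hX hf
  exact congrArg (fun L : TangentSpace (𝓡 d) x →L[ℝ] TangentSpace (𝓡 d) x ↦ L u) this

theorem curvatureField_swap (nab : AffineConnection d M) :
    curvatureField nab U V W x = -curvatureField nab V U W x := by
  simp only [curvatureField]
  rw [mlieBracket_swap_apply (V := U), map_neg]
  abel

theorem curvatureField_sub [T2Space M] (hnab : nab.ContMDiffCovariantDerivative ∞)
    (hU : SmoothFieldNear U x) (hV : SmoothFieldNear V x)
    (hW : SmoothFieldNear W x) (hZ : SmoothFieldNear Z x) :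
    curvatureField nab U V (W - Z) x = curvatureField nab U V W x - curvatureField nab U V Z x := by
  have key {A B : Π x : M, TangentSpace (𝓡 d) x} (hB : SmoothFieldNear B x) :
      nab (fun y ↦ nab (W - Z) y (B y)) x (A x) =
        nab (fun y ↦ nab W y (B y)) x (A x) - nab (fun y ↦ nab Z y (B y)) x (A x) := by
    have h1 : (fun y ↦ nab (W - Z) y (B y)) =ᶠ[𝓝 x]
        (fun y ↦ nab W y (B y)) - (fun y ↦ nab Z y (B y)) := by
      filter_upwards [hW.eventually, hZ.eventually] with y hy hy'
      rw [nab.apply_sub hy hy']; rfl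
    have h2 := hW.nab_apply hnab hB
    have h3 := hZ.nab_apply hnab hB
    rw [nab.congr ((h2.sub h3).congr h1).diffFieldAt (h2.sub h3).diffFieldAt h1,
      nab.apply_sub h2 h3]
    rfl
  simp only [curvatureField]
  rw [key hV, key hU, nab.apply_sub hW hZ]
  simp only [sub_apply]
  abel

namespace LorentzianMetric.IsLeviCivita

variable (hnab : h.IsLeviCivita nab)
include hnab

theorem mlieBracket_eventuallyEq (hX : SmoothFieldNear X x) (hY : SmoothFieldNear Y x) :
    mlieBracket (𝓡 d) X Y =ᶠ[𝓝 x] (fun y ↦ nab Y y (X y)) - (fun y ↦ nab X y (Y y)) := by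
  filter_upwards [hX.eventually, hY.eventually] with y h1 h2
  exact (hnab.torsion_free X Y y h1.diffFieldAt h2.diffFieldAt).symm

theorem mvfderiv_eventuallyEq (V : Π x : M, TangentSpace (𝓡 d) x)
    (hW : SmoothFieldNear W x) (hZ : SmoothFieldNear Z x) :
    (fun y ↦ mvfderiv (𝓡 d) (fun y ↦ h.val y (W y) (Z y)) y (V y)) =ᶠ[𝓝 x]
      (fun y ↦ h.val y (nab W y (V y)) (Z y)) + (fun y ↦ h.val y (W y) (nab Z y (V y))) := by
  filter_upwards [hW.eventually, hZ.eventually] with y h1 h2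
  exact hnab.metric W Z y _ h1.diffFieldAt h2.diffFieldAt

variable [T2Space M]

/-- Metricity writes the derivative as a sum of two smooth functions; this supplies the
differentiability hypotheses of `mvfderiv_commutator`. -/
theorem mdifferentiableAt_mvfderiv (hV : SmoothFieldNear V x) (hW : SmoothFieldNear W x)
    (hZ : SmoothFieldNear Z x) :
    MDifferentiableAt (𝓡 d) 𝓘(ℝ)
      (fun y ↦ mvfderiv (𝓡 d) (fun y ↦ h.val y (W y) (Z y)) y (V y)) x := by
  have h1 := (h.eventually_contMDiffAt_apply (hW.nab_apply hnab.smooth hV) hZ).self_of_nhds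
  have h2 := (h.eventually_contMDiffAt_apply hW (hZ.nab_apply hnab.smooth hV)).self_of_nhds
  exact ((h1.mdifferentiableAt (by simp)).add (h2.mdifferentiableAt (by simp))).congr_of_eventuallyEq
    (hnab.mvfderiv_eventuallyEq V hW hZ)

theorem mvfderiv_mvfderiv (hV : SmoothFieldNear V x) (hW : SmoothFieldNear W x)
    (hZ : SmoothFieldNear Z x) (u : TangentSpace (𝓡 d) x) :
    mvfderiv (𝓡 d) (fun y ↦ mvfderiv (𝓡 d) (fun y ↦ h.val y (W y) (Z y)) y (V y)) x u =
      h.val x (nab (fun y ↦ nab W y (V y)) x u) (Z x) + h.val x (nab W x (V x)) (nab Z x u)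
      + (h.val x (nab W x u) (nab Z x (V x)) + h.val x (W x) (nab (fun y ↦ nab Z y (V y)) x u)) := by
  have hW' := hW.nab_apply hnab.smooth hV
  have hZ' := hZ.nab_apply hnab.smooth hV
  have h1 := (h.eventually_contMDiffAt_apply hW' hZ).self_of_nhds
  have h2 := (h.eventually_contMDiffAt_apply hW hZ').self_of_nhds
  rw [(hnab.mvfderiv_eventuallyEq V hW hZ).mvfderiv_eq,
    mvfderiv_add (h1.mdifferentiableAt (by simp)) (h2.mdifferentiableAt (by simp)),
    add_apply, hnab.metric _ _ x u hW'.diffFieldAt hZ.diffFieldAt,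
    hnab.metric _ _ x u hW.diffFieldAt hZ'.diffFieldAt]

/-- The commutator identity is applied to the function `h(W, Z)`. After expansion by metricity the
mixed first-order terms cancel, and what remains is `h(R W, Z) + h(W, R Z) = 0`. -/
theorem curvatureField_anti_right (hU : SmoothFieldNear U x) (hV : SmoothFieldNear V x)
    (hW : SmoothFieldNear W x) (hZ : SmoothFieldNear Z x) :
    h.val x (curvatureField nab U V W x) (Z x) = -h.val x (curvatureField nab U V Z x) (W x) := by
  have key := mvfderiv_commutator hU hV (h.eventually_contMDiffAt_apply hW hZ)
    (hnab.mdifferentiableAt_mvfderiv hU hW hZ) (hnab.mdifferentiableAt_mvfderiv hV hW hZ)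
  rw [hnab.mvfderiv_mvfderiv hV hW hZ, hnab.mvfderiv_mvfderiv hU hW hZ,
    hnab.metric _ _ x _ hW.diffFieldAt hZ.diffFieldAt] at key
  rw [h.symm x (curvatureField nab U V Z x)]
  simp only [curvatureField, map_sub, sub_apply]
  linarith

/-- Without torsion, the cyclic sum of curvatures is the cyclic sum of the double brackets `[U, [V,
W]]`, which vanishes by the Jacobi identity. -/
theorem curvatureField_bianchi (hU : SmoothFieldNear U x) (hV : SmoothFieldNear V x)
    (hW : SmoothFieldNear W x) :
    curvatureField nab U V W x + curvatureField nab V W U x + curvatureField nab W U V x = 0 := by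
  have key {A B : Π x : M, TangentSpace (𝓡 d) x} (hA : SmoothFieldNear A x)
      (hB : SmoothFieldNear B x) :
      nab (mlieBracket (𝓡 d) A B) x =
        nab (fun y ↦ nab B y (A y)) x - nab (fun y ↦ nab A y (B y)) x := by
    have h1 := hnab.mlieBracket_eventuallyEq hA hB
    have h2 := hB.nab_apply hnab.smooth hA
    have h3 := hA.nab_apply hnab.smooth hB
    rw [nab.congr ((h2.sub h3).congr h1).diffFieldAt (h2.sub h3).diffFieldAt h1,
      nab.apply_sub h2 h3]
  have tf {A B : Π x : M, TangentSpace (𝓡 d) x} (hA : SmoothFieldNear A x)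
      (hB : SmoothFieldNear B x) :=
    hnab.torsion_free A B x hA.diffFieldAt hB.diffFieldAt
  have t1 := tf hU (hV.mlieBracket hW)
  have t2 := tf hV (hW.mlieBracket hU)
  have t3 := tf hW (hU.mlieBracket hV)
  rw [key hV hW] at t1
  rw [key hW hU] at t2
  rw [key hU hV] at t3
  have hj := hU.jacobi hV hW
  rw [mlieBracket_swap_apply (V := mlieBracket (𝓡 d) U V), ← t1, ← t3] at hj
  have hsw : mlieBracket (𝓡 d) V (mlieBracket (𝓡 d) U W) x =
      - mlieBracket (𝓡 d) V (mlieBracket (𝓡 d) W U) x := by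
    rw [mlieBracket_swap (V := U) (W := W)]
    have : IsManifold (𝓡 d) (minSmoothness ℝ 2) M := isManifold_minSmoothness 2
    have := mlieBracket_const_smul_right (I := 𝓡 d) (c := (-1 : ℝ)) (V := V)
      (hW.mlieBracket hU).diffFieldAt
    simpa using this
  rw [hsw, ← t2, ← sub_eq_zero] at hj
  simp only [sub_apply] at hj
  rw [← hj]
  simp only [curvatureField]
  abel

/-- The classical octahedron argument: four instances of the Bianchi identity, one for each omitted
field, combined by the two skew symmetries. -/
theorem curvatureField_pair (hU : SmoothFieldNear U x) (hV : SmoothFieldNear V x)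
    (hW : SmoothFieldNear W x) (hZ : SmoothFieldNear Z x) :
    h.val x (curvatureField nab U V W x) (Z x) = h.val x (curvatureField nab W Z U x) (V x) := by
  have b {A B C D : Π x : M, TangentSpace (𝓡 d) x} (hA : SmoothFieldNear A x)
      (hB : SmoothFieldNear B x) (hC : SmoothFieldNear C x) :
      h.val x (curvatureField nab A B C x) (D x) + h.val x (curvatureField nab B C A x) (D x)
        + h.val x (curvatureField nab C A B x) (D x) = 0 := by
    have := congrArg (fun v ↦ h.val x v (D x)) (hnab.curvatureField_bianchi hA hB hC)
    simpa using this
  have s {A B C D : Π x : M, TangentSpace (𝓡 d) x} :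
      h.val x (curvatureField nab A B C x) (D x) = -h.val x (curvatureField nab B A C x) (D x) := by
    rw [curvatureField_swap]; simp
  have a {A B C D : Π x : M, TangentSpace (𝓡 d) x} (hA : SmoothFieldNear A x)
      (hB : SmoothFieldNear B x) (hC : SmoothFieldNear C x) (hD : SmoothFieldNear D x) :=
    hnab.curvatureField_anti_right hA hB hC hD
  have b1 := b (D := Z) hU hV hW
  have b2 := b (D := U) hV hW hZ
  have b3 := b (D := V) hW hZ hU
  have b4 := b (D := W) hZ hU hV
  have := a hW hU hV hZ
  have := a hU hV hW hZ
  have := a hW hZ hU hV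
  have := s (A := Z) (B := V) (C := U) (D := W)
  have := s (A := U) (B := W) (C := Z) (D := V)
  have := a hZ hV hW hU
  have := a hV hW hZ hU
  have := a hZ hU hV hW
  linarith

/-- The curvature is tensorial in its last argument. -/
theorem curvatureField_congr_right (hU : SmoothFieldNear U x) (hV : SmoothFieldNear V x)
    (hW : SmoothFieldNear W x) (hZ : SmoothFieldNear Z x) (hWZ : W x = Z x) :
    curvatureField nab U V W x = curvatureField nab U V Z x := by
  rw [← sub_eq_zero, ← curvatureField_sub hnab.smooth hU hV hW hZ]
  refine (h.bilin_nondegenerate x).1 _ fun w ↦ ?_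
  -- Skew symmetry moves `W - Z` out of the derivatives into a slot where only its value at `x`,
  -- which is zero, matters.
  have := hnab.curvatureField_anti_right hU hV (hW.sub hZ) (SmoothFieldNear.extend w)
  rw [extend_apply_self] at this
  rw [LorentzianMetric.bilin_apply, this, Pi.sub_apply, hWZ, sub_self, map_zero, neg_zero]

/-- The curvature endomorphism can be computed with any smooth extensions. -/
theorem curvatureField_eq_curv (hU : SmoothFieldNear U x) (hV : SmoothFieldNear V x)
    (hW : SmoothFieldNear W x) :
    curvatureField nab U V W x = curv nab x (U x) (V x) (W x) := by
  have hu := SmoothFieldNear.extend (U x)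
  have hv := SmoothFieldNear.extend (V x)
  have hw := SmoothFieldNear.extend (W x)
  have hux := extend_apply_self (EuclideanSpace ℝ (Fin d)) (U x)
  have hvx := extend_apply_self (EuclideanSpace ℝ (Fin d)) (V x)
  have hwx := extend_apply_self (EuclideanSpace ℝ (Fin d)) (W x)
  rw [curv, hnab.curvatureField_congr_right hU hV hW hw hwx.symm]
  rw [← sub_eq_zero]
  refine (h.bilin_nondegenerate x).1 _ fun z ↦ ?_
  have hz := SmoothFieldNear.extend z
  have hzx := extend_apply_self (EuclideanSpace ℝ (Fin d)) z
  -- Pair symmetry moves `V` into a slot of the metric and `U` into the last argument of the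
  -- curvature, where tensoriality is known.
  rw [LorentzianMetric.bilin_apply, map_sub, sub_apply, sub_eq_zero, ← hzx,
    hnab.curvatureField_pair hU hV hw hz, hnab.curvatureField_pair hu hv hw hz, hvx,
    hnab.curvatureField_congr_right hw hz hU hu hux.symm]

theorem isCurvatureLike (x : M) : IsCurvatureLike (h.bilin x) (curv nab x) := by
  have e (u : TangentSpace (𝓡 d) x) := SmoothFieldNear.extend u
  have ex (u : TangentSpace (𝓡 d) x) := extend_apply_self (EuclideanSpace ℝ (Fin d)) u
  refine ⟨fun u v w z ↦ ?_, fun u v w z ↦ ?_, fun u v w z ↦ ?_⟩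
  · rw [curv, curvatureField_swap, map_neg]; rfl
  · have := hnab.curvatureField_anti_right (e u) (e v) (e w) (e z)
    rwa [ex, ex] at this
  · have := hnab.curvatureField_pair (e u) (e v) (e w) (e z)
    rwa [ex, ex] at this

end LorentzianMetric.IsLeviCivita

theorem LorentzianMetric.isLorentzian (h : LorentzianMetric d M) (x : M) :
    (h.bilin x).IsLorentzian :=
  ⟨h.symm x, h.index_one x⟩

theorem LorentzianMetric.isDualFrame (h : LorentzianMetric d M) (x : M) :
    (h.bilin x).IsDualFrame (basis x) (h.cobasis x) := by
  have hl (p : TangentSpace (𝓡 d) x) : ∑ i, h.bilin x p (basis x i) • h.cobasis x i = p := by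
    conv_rhs => rw [← (h.cobasis x).sum_repr p]
    refine Finset.sum_congr rfl fun i _ ↦ ?_
    congr 1
    exact (LinearMap.BilinForm.dualBasis_repr_apply _ _ _ _).symm
  refine ⟨hl, fun p ↦ ?_⟩
  -- The second expansion is the transpose of the first, by symmetry and nondegeneracy of the form.
  refine sub_eq_zero.1 ((h.bilin_nondegenerate x).2 _ fun w ↦ ?_)
  have := congrArg (h.bilin x p) (hl w)
  simp only [map_sub, map_sum, map_smul, smul_eq_mul] at this ⊢
  rw [(h.isLorentzian x).symm w p, ← this, sub_eq_zero]
  exact Finset.sum_congr rfl fun i _ ↦ mul_comm _ _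

end Curvature

/-! ### Closed one-forms: local primitives, and global ones on simply connected manifolds. -/

section Poincare

variable {d : ℕ} {M : Type*} [TopologicalSpace M]
  [ChartedSpace (EuclideanSpace ℝ (Fin d)) M]

theorem mvfderiv_comp_extChartAt [IsManifold (𝓡 d) ∞ M] {p y : M}
    (hy : y ∈ (extChartAt (𝓡 d) p).source)
    {g : EuclideanSpace ℝ (Fin d) → ℝ} (hg : DifferentiableAt ℝ g (extChartAt (𝓡 d) p y))
    (v : TangentSpace (𝓡 d) y) :
    mvfderiv (𝓡 d) (g ∘ extChartAt (𝓡 d) p) y v =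
      fderiv ℝ g (extChartAt (𝓡 d) p y) (mfderiv (𝓡 d) 𝓘(ℝ, EuclideanSpace ℝ (Fin d))
        (extChartAt (𝓡 d) p) y v) := by
  rw [extChartAt_source] at hy
  rw [mvfderiv_comp_apply y hg.mdifferentiableAt (mdifferentiableAt_extChartAt hy)]
  simp only [mvfderiv, mfderiv_eq_fderiv]
  rfl

variable [IsManifold (𝓡 d) ∞ M]

/-- The constant vector field on the model space. -/
def constField (w : EuclideanSpace ℝ (Fin d)) :
    Π z : EuclideanSpace ℝ (Fin d), TangentSpace 𝓘(ℝ, EuclideanSpace ℝ (Fin d)) z := fun _ ↦ w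

/-- The vector field with constant coefficients `w` in the chart at `p`. -/
noncomputable def coordField (p : M) (w : EuclideanSpace ℝ (Fin d)) :
    Π x : M, TangentSpace (𝓡 d) x :=
  mpullback (𝓡 d) 𝓘(ℝ, EuclideanSpace ℝ (Fin d)) (extChartAt (𝓡 d) p) (constField w)

variable {p y : M}

theorem mfderiv_coordField (hy : y ∈ (extChartAt (𝓡 d) p).source)
    (w : EuclideanSpace ℝ (Fin d)) :
    mfderiv (𝓡 d) 𝓘(ℝ, EuclideanSpace ℝ (Fin d)) (extChartAt (𝓡 d) p) y (coordField p w y) = w :=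
  (isInvertible_mfderiv_extChartAt hy).self_apply_inverse _

theorem coordField_mfderiv (hy : y ∈ (extChartAt (𝓡 d) p).source) (v : TangentSpace (𝓡 d) y) :
    coordField p (mfderiv (𝓡 d) 𝓘(ℝ, EuclideanSpace ℝ (Fin d)) (extChartAt (𝓡 d) p) y v) y = v :=
  (isInvertible_mfderiv_extChartAt hy).inverse_apply_self _

theorem contMDiff_const_field (w : EuclideanSpace ℝ (Fin d)) :
    ContMDiff 𝓘(ℝ, EuclideanSpace ℝ (Fin d)) (𝓘(ℝ, EuclideanSpace ℝ (Fin d)).prod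
      𝓘(ℝ, EuclideanSpace ℝ (Fin d))) ∞
      (fun z ↦ (⟨z, constField w z⟩ : TangentBundle 𝓘(ℝ, EuclideanSpace ℝ (Fin d))
        (EuclideanSpace ℝ (Fin d)))) :=
  contMDiff_vectorSpace_iff_contDiff.2 contDiff_const

theorem smoothFieldNear_coordField (hy : y ∈ (extChartAt (𝓡 d) p).source)
    (w : EuclideanSpace ℝ (Fin d)) : SmoothFieldNear (coordField p w) y := by
  filter_upwards [(isOpen_extChartAt_source p).mem_nhds hy] with x hx
  refine ContMDiffAt.mpullback_vectorField_preimage (n := ∞) (contMDiff_const_field w _)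
    (contMDiffAt_extChartAt' (by rwa [extChartAt_source] at hx))
    (isInvertible_mfderiv_extChartAt hx) le_rfl

theorem mlieBracket_const_field (v w z : EuclideanSpace ℝ (Fin d)) :
    mlieBracket 𝓘(ℝ, EuclideanSpace ℝ (Fin d)) (constField v) (constField w) z = 0 := by
  rw [← mlieBracketWithin_univ]
  refine (congrFun mlieBracketWithin_eq_lieBracketWithin z).trans ?_
  change lieBracketWithin ℝ (fun _ : EuclideanSpace ℝ (Fin d) ↦ v) (fun _ ↦ w) Set.univ z = 0
  simp [lieBracketWithin]

theorem mlieBracket_coordField (hy : y ∈ (extChartAt (𝓡 d) p).source)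
    (v w : EuclideanSpace ℝ (Fin d)) :
    mlieBracket (𝓡 d) (coordField p v) (coordField p w) y = 0 := by
  have : IsManifold (𝓡 d) (minSmoothness ℝ 3) M := isManifold_minSmoothness 3
  have : IsManifold 𝓘(ℝ, EuclideanSpace ℝ (Fin d)) (minSmoothness ℝ 3)
    (EuclideanSpace ℝ (Fin d)) := isManifold_minSmoothness 3
  have h2 : minSmoothness ℝ 2 ≤ ∞ := by
    rw [minSmoothness_of_isRCLikeNormedField]; exact WithTop.coe_le_coe.2 (le_top : (2 : ℕ∞) ≤ ⊤)
  rw [coordField, coordField, ← mpullback_mlieBracket (n := ∞)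
    ((contMDiff_const_field v).mdifferentiable (by simp) _)
    ((contMDiff_const_field w).mdifferentiable (by simp) _)
    (contMDiffAt_extChartAt' (by rwa [extChartAt_source] at hy)) h2]
  exact (congrArg _ (mlieBracket_const_field v w _)).trans (map_zero _)

/-- Poincaré lemma: a closed smooth one-form on a manifold is locally exact. -/
theorem exists_local_primitive {Θ : Π x : M, TangentSpace (𝓡 d) x →L[ℝ] ℝ}
    (hΘ : ContMDiff (𝓡 d) ((𝓡 d).prod 𝓘(ℝ, EuclideanSpace ℝ (Fin d) →L[ℝ] ℝ)) ∞
      (fun x ↦ TotalSpace.mk' (EuclideanSpace ℝ (Fin d) →L[ℝ] ℝ) x (Θ x)))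
    (hcl : ∀ (V W : Π x : M, TangentSpace (𝓡 d) x) (x : M), SmoothFieldNear V x →
      SmoothFieldNear W x →
      mvfderiv (𝓡 d) (fun y ↦ Θ y (W y)) x (V x) - mvfderiv (𝓡 d) (fun y ↦ Θ y (V y)) x (W x)
        - Θ x (mlieBracket (𝓡 d) V W x) = 0) (p : M) :
    ∃ U : Set M, IsOpen U ∧ p ∈ U ∧ ∃ g : M → ℝ, ContMDiffOn (𝓡 d) 𝓘(ℝ) ∞ g U ∧
      ∀ x ∈ U, mvfderiv (𝓡 d) g x = Θ x := by
  set e := extChartAt (𝓡 d) p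
  let φ (w : EuclideanSpace ℝ (Fin d)) (y : M) : ℝ := Θ y (coordField p w y)
  let θ (z : EuclideanSpace ℝ (Fin d)) : EuclideanSpace ℝ (Fin d) →L[ℝ] ℝ :=
    (Θ (e.symm z)).comp (mfderiv (𝓡 d) 𝓘(ℝ, EuclideanSpace ℝ (Fin d)) e (e.symm z)).inverse
  have hθφ (z w) : θ z w = φ w (e.symm z) := rfl
  have hto : IsOpen e.target := isOpen_extChartAt_target p
  have hφ (w) : ContMDiffOn (𝓡 d) 𝓘(ℝ) ∞ (φ w) e.source := fun y hy ↦
    (eventually_contMDiffAt_form_apply hΘ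
      (smoothFieldNear_coordField hy w)).self_of_nhds.contMDiffWithinAt
  have hθ : ContDiffOn ℝ ∞ θ e.target := by
    refine contDiffOn_clm_apply.2 fun w ↦ contMDiffOn_iff_contDiffOn.1 ?_
    exact (hφ w).comp (contMDiffOn_extChartAt_symm p) fun z hz ↦ e.map_target hz
  have hθd {z} (hz : z ∈ e.target) : DifferentiableAt ℝ θ z :=
    (hθ.contDiffAt (hto.mem_nhds hz)).differentiableAt (by simp)
  have hder {y : M} (hy : y ∈ e.source) (u w) :
      mvfderiv (𝓡 d) (φ w) y (coordField p u y) = fderiv ℝ θ (e y) u w := by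
    have h1 : φ w =ᶠ[𝓝 y] (fun z ↦ θ z w) ∘ e := by
      filter_upwards [(isOpen_extChartAt_source p).mem_nhds hy] with x hx
      rw [Function.comp_apply, hθφ, e.left_inv hx]
    have hd := hθd (e.map_source hy)
    rw [h1.mvfderiv_eq, mvfderiv_comp_extChartAt hy (hd.clm_apply (differentiableAt_const w)),
      mfderiv_coordField hy, fderiv_clm_apply hd (differentiableAt_const w)]
    simp
  -- Coordinate fields have vanishing bracket, so closedness evaluated on them is symmetry of the
  -- derivative of `θ`.
  have hsymm (z) (hz : z ∈ e.target) (u w) : fderiv ℝ θ z u w = fderiv ℝ θ z w u := by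
    have hy := e.map_target hz
    have := hcl _ _ _ (smoothFieldNear_coordField hy u) (smoothFieldNear_coordField hy w)
    rw [mlieBracket_coordField hy, map_zero, sub_zero, sub_eq_zero] at this
    rw [← e.right_inv hz, ← hder hy, ← hder hy]
    exact this
  obtain ⟨r, hr, hball⟩ := Metric.isOpen_iff.1 hto (e p) (mem_extChartAt_target p)
  obtain ⟨g, hg⟩ := (convex_ball (e p) r).exists_forall_hasFDerivAt_of_fderiv_symmetric
    Metric.isOpen_ball (fun z hz ↦ (hθd (hball hz)).differentiableWithinAt)
    fun z hz ↦ hsymm z (hball hz)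
  -- The derivative of `g` is the smooth map `θ`, so `g` is itself smooth.
  have hgs : ContDiffOn ℝ ∞ g (Metric.ball (e p) r) := by
    rw [contDiffOn_infty_iff_fderiv_of_isOpen Metric.isOpen_ball]
    exact ⟨fun z hz ↦ (hg z hz).differentiableAt.differentiableWithinAt,
      (hθ.mono hball).congr fun z hz ↦ (hg z hz).fderiv⟩
  refine ⟨e.source ∩ e ⁻¹' Metric.ball (e p) r,
    isOpen_extChartAt_preimage' p Metric.isOpen_ball,
    ⟨mem_extChartAt_source p, Metric.mem_ball_self hr⟩, g ∘ e, ?_, fun y hy ↦ ?_⟩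
  · exact hgs.contMDiffOn.comp ((contMDiffOn_extChartAt (n := ∞)).mono fun y hy ↦ by
      simpa [e] using hy.1) fun y hy ↦ hy.2
  · ext v
    rw [mvfderiv_comp_extChartAt hy.1 (hg _ hy.2).differentiableAt, (hg _ hy.2).fderiv]
    refine (hθφ _ _).trans ?_
    rw [e.left_inv hy.1]
    exact congrArg (Θ y) (coordField_mfderiv hy.1 v)

/-- Two functions with the same differential differ locally by a constant. -/
theorem eventually_sub_eq_of_mvfderiv_eq {f g : M → ℝ} {U : Set M} (hU : IsOpen U) {x : M}
    (hx : x ∈ U) (hf : ContMDiffOn (𝓡 d) 𝓘(ℝ) ∞ f U) (hg : ContMDiffOn (𝓡 d) 𝓘(ℝ) ∞ g U)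
    (hfg : ∀ y ∈ U, mvfderiv (𝓡 d) f y = mvfderiv (𝓡 d) g y) :
    ∀ᶠ y in 𝓝 x, f y - g y = f x - g x := by
  set e := extChartAt (𝓡 d) x
  set F := fun z ↦ f (e.symm z) - g (e.symm z)
  set S := e.target ∩ e.symm ⁻¹' U
  have hS : IsOpen S :=
    (continuousOn_extChartAt_symm x).isOpen_inter_preimage (isOpen_extChartAt_target x) hU
  have hF : ContDiffOn ℝ ∞ F S := by
    refine contMDiffOn_iff_contDiffOn.1 ?_
    exact (hf.sub hg).comp ((contMDiffOn_extChartAt_symm x).mono Set.inter_subset_left)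
      fun z hz ↦ hz.2
  have hFd {z} (hz : z ∈ S) : DifferentiableAt ℝ F z :=
    (hF.contDiffAt (hS.mem_nhds hz)).differentiableAt (by simp)
  have hF0 (z) (hz : z ∈ S) : fderiv ℝ F z = 0 := by
    ext w
    have hy : e.symm z ∈ e.source := e.map_target hz.1
    have hez : e (e.symm z) = z := e.right_inv hz.1
    have h1 : f - g =ᶠ[𝓝 (e.symm z)] F ∘ e := by
      filter_upwards [(isOpen_extChartAt_source x).mem_nhds hy] with y hy
      simp only [F, Function.comp_apply, Pi.sub_apply]
      rw [e.left_inv hy]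
    have h2 := mvfderiv_comp_extChartAt hy (g := F) (by rw [hez]; exact hFd hz)
      (coordField x w (e.symm z))
    have hd {k : M → ℝ} (hk : ContMDiffOn (𝓡 d) 𝓘(ℝ) ∞ k U) :
        MDifferentiableAt (𝓡 d) 𝓘(ℝ) k (e.symm z) :=
      (hk.contMDiffAt (hU.mem_nhds hz.2)).mdifferentiableAt (by simp)
    rw [← h1.mvfderiv_eq, mvfderiv_sub (hd hf) (hd hg), hfg _ hz.2, sub_self,
      mfderiv_coordField hy, hez] at h2
    exact h2.symm
  have hxS : e x ∈ S := ⟨mem_extChartAt_target x, by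
    rw [Set.mem_preimage, e.left_inv (mem_extChartAt_source x)]; exact hx⟩
  obtain ⟨r, hr, hball⟩ := Metric.isOpen_iff.1 hS (e x) hxS
  have hn : e.source ∩ e ⁻¹' Metric.ball (e x) r ∈ 𝓝 x :=
    (isOpen_extChartAt_preimage' x Metric.isOpen_ball).mem_nhds
      ⟨mem_extChartAt_source x, Metric.mem_ball_self hr⟩
  filter_upwards [hn] with y hy
  have := Metric.isOpen_ball.is_const_of_fderiv_eq_zero (convex_ball (e x) r).isPreconnected
    (fun z hz ↦ (hFd (hball hz)).differentiableWithinAt)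
    (fun z hz ↦ hF0 z (hball hz)) hy.2 (Metric.mem_ball_self hr)
  simp only [F] at this
  rwa [e.left_inv hy.1, e.left_inv (mem_extChartAt_source x)] at this

/-- A copy of the real line with the discrete topology. -/
@[ext]
structure DiscreteLine where
  /-- The underlying real number. -/
  val : ℝ

instance : TopologicalSpace DiscreteLine := ⊥

instance : DiscreteTopology DiscreteLine := ⟨rfl⟩

/-- The covering space of local primitives of a one-form: local primitives `g i` on `U i` which
differ by locally constant functions define a fibre bundle with discrete fibre. -/
def primitiveCore {B : Type*} [TopologicalSpace B] (U : B → Set B)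
    (hU : ∀ i, IsOpen (U i)) (hmem : ∀ i, i ∈ U i) (g : B → B → ℝ)
    (hg : ∀ i j, ∀ x ∈ U i ∩ U j, ∀ᶠ y in 𝓝 x, g i y - g j y = g i x - g j x) :
    FiberBundleCore B B DiscreteLine where
  baseSet := U
  isOpen_baseSet := hU
  indexAt := id
  mem_baseSet_at := hmem
  coordChange i j x v := ⟨v.val + (g i x - g j x)⟩
  coordChange_self i x _ v := by
    ext
    ring
  continuousOn_coordChange i j := by
    rintro ⟨x, v⟩ ⟨hx, -⟩
    refine ContinuousAt.continuousWithinAt ?_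
    -- The transition is locally constant: the fibre is discrete and `g i - g j` is locally
    -- constant.
    refine (continuousAt_const (y := (⟨v.val + (g i x - g j x)⟩ : DiscreteLine))).congr ?_
    have h1 : ∀ᶠ q : B × DiscreteLine in 𝓝 (x, v), q.2 = v :=
      continuousAt_snd.eventually (p := (· = v)) (IsOpen.mem_nhds (isOpen_discrete {v}) rfl)
    have h2 : ∀ᶠ q : B × DiscreteLine in 𝓝 (x, v), g i q.1 - g j q.1 = g i x - g j x :=
      (continuous_fst.tendsto (x, v)).eventually (p := fun y ↦ g i y - g j y = g i x - g j x)
        (hg i j x hx)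
    filter_upwards [h1, h2] with q hq1 hq2
    rw [hq1, hq2]
  coordChange_comp i j k x _ v := by
    ext
    ring

/-- On a simply connected space, compatible local primitives glue to a global one. -/
theorem exists_global_of_local {B : Type*} [TopologicalSpace B] [SimplyConnectedSpace B]
    [LocallyPathConnectedSpace B] (U : B → Set B)
    (hU : ∀ i, IsOpen (U i)) (hmem : ∀ i, i ∈ U i) (g : B → B → ℝ)
    (hg : ∀ i j, ∀ x ∈ U i ∩ U j, ∀ᶠ y in 𝓝 x, g i y - g j y = g i x - g j x) :
    ∃ G : B → ℝ, ∀ x, ∀ᶠ y in 𝓝 x, G y - g x y = G x - g x x := by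
  set Z := primitiveCore U hU hmem g hg
  have hcov : IsCoveringMap (π DiscreteLine Z.Fiber) := FiberBundle.isCoveringMap
  obtain ⟨a⟩ : Nonempty B := inferInstance
  -- Simple connectedness lifts the identity to a continuous section of the covering; its value over
  -- the base point is an arbitrary constant of integration.
  obtain ⟨F, ⟨-, hF⟩, -⟩ := hcov.existsUnique_continuousMap_lifts (ContinuousMap.id B) a
    ⟨a, (⟨0⟩ : DiscreteLine)⟩ rfl
  have hFx (x) : (F x).proj = x := congrFun hF x
  let c (x : B) : DiscreteLine := (F x).2
  -- The fibre coordinate `c y` refers to the chart indexed by `y` itself. Read in the fixed chart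
  -- of `x` it becomes `c y + g y y - g x y`, which is locally constant because the fibre is
  -- discrete.
  refine ⟨fun x ↦ (c x).val + g x x, fun x ↦ ?_⟩
  have h1 : ContinuousAt (fun y ↦ (Z.localTriv x (F y)).2) x := by
    refine continuousAt_snd.comp (ContinuousAt.comp (g := Z.localTriv x)
      ((Z.localTriv x).continuousAt ?_) F.continuous.continuousAt)
    rw [Z.mem_localTriv_source, hFx]
    exact hmem x
  have h2 := h1.eventually
    (p := (· = (Z.localTriv x (F x)).2)) (IsOpen.mem_nhds (isOpen_discrete {(Z.localTriv x (F x)).2}) rfl)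
  have h3 (y) : (Z.localTriv x (F y)).2.val = (c y).val + (g y y - g x y) := by
    have h4 : (Z.localTriv x (F y)).2.val =
      (c y).val + (g (F y).proj (F y).proj - g x (F y).proj) := rfl
    rwa [hFx y] at h4
  filter_upwards [h2] with y hy
  have h4 := congrArg DiscreteLine.val hy
  rw [h3, h3] at h4
  linarith

/-- A closed smooth one-form on a simply connected manifold is exact. -/
theorem exists_primitive [SimplyConnectedSpace M] {Θ : Π x : M, TangentSpace (𝓡 d) x →L[ℝ] ℝ}
    (hloc : ∀ p : M, ∃ U : Set M, IsOpen U ∧ p ∈ U ∧ ∃ g : M → ℝ, ContMDiffOn (𝓡 d) 𝓘(ℝ) ∞ g U ∧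
      ∀ x ∈ U, mvfderiv (𝓡 d) g x = Θ x) :
    ∃ g : M → ℝ, ContMDiff (𝓡 d) 𝓘(ℝ) ∞ g ∧ ∀ x, mvfderiv (𝓡 d) g x = Θ x := by
  choose U hU hmem g hgs hgd using hloc
  have : LocallyPathConnectedSpace M :=
    ChartedSpace.locallyPathConnectedSpace (EuclideanSpace ℝ (Fin d)) M
  obtain ⟨G, hG⟩ := exists_global_of_local U hU hmem g fun i j x hx ↦
    eventually_sub_eq_of_mvfderiv_eq ((hU i).inter (hU j)) hx
      ((hgs i).mono Set.inter_subset_left) ((hgs j).mono Set.inter_subset_right)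
      fun y hy ↦ by rw [hgd i y hy.1, hgd j y hy.2]
  have hG' (x) : G =ᶠ[𝓝 x] fun y ↦ g x y + (G x - g x x) := by
    filter_upwards [hG x] with y hy
    linarith
  have hgx (x) : ContMDiffAt (𝓡 d) 𝓘(ℝ) ∞ (g x) x :=
    (hgs x).contMDiffAt ((hU x).mem_nhds (hmem x))
  refine ⟨G, fun x ↦ ?_, fun x ↦ ?_⟩
  · exact ((hgx x).add contMDiffAt_const).congr_of_eventuallyEq (hG' x)
  · have := mvfderiv_add ((hgx x).mdifferentiableAt (by simp))
      (mdifferentiableAt_const (c := G x - g x x) (x := x) (I := 𝓡 d))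
    rw [(hG' x).mvfderiv_eq, ← hgd x x (hmem x)]
    refine this.trans ?_
    rw [mvfderiv_const, add_zero]

end Poincare

/-! ### Recurrent null fields: closed recurrence form, rescaling, and the comparison with pp-waves.
-/

section PRWave

variable {d : ℕ} {M : Type*} [TopologicalSpace M]
  [ChartedSpace (EuclideanSpace ℝ (Fin d)) M] [IsManifold (𝓡 d) ∞ M]
  {h : LorentzianMetric d M} {nab : AffineConnection d M}
  {X : Π x : M, TangentSpace (𝓡 d) x} {Θ : Π x : M, TangentSpace (𝓡 d) x →L[ℝ] ℝ} {x : M}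

namespace LorentzianMetric

theorem IsPRField.smoothFieldNear (hX : h.IsPRField nab X Θ) (x : M) : SmoothFieldNear X x :=
  hX.lightlike.smooth.near isOpen_univ (Set.mem_univ x)

/-- The curvature acts on a recurrent field through the differential of its recurrence form. -/
theorem IsPRField.curvatureField_eq (hX : h.IsPRField nab X Θ)
    {V W : Π x : M, TangentSpace (𝓡 d) x} (hV : SmoothFieldNear V x) (hW : SmoothFieldNear W x) :
    curvatureField nab V W X x =
      (mvfderiv (𝓡 d) (fun y ↦ Θ y (W y)) x (V x) - mvfderiv (𝓡 d) (fun y ↦ Θ y (V y)) x (W x)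
        - Θ x (mlieBracket (𝓡 d) V W x)) • X x := by
  have key {A : Π x : M, TangentSpace (𝓡 d) x} (hA : SmoothFieldNear A x)
      (u : TangentSpace (𝓡 d) x) : nab (fun y ↦ nab X y (A y)) x u =
        Θ x (A x) • Θ x u • X x + mvfderiv (𝓡 d) (fun y ↦ Θ y (A y)) x u • X x := by
    have h1 : (fun y ↦ nab X y (A y)) = fun y ↦ Θ y (A y) • X y := by
      ext1 y
      rw [hX.recurrent]
    have h2 := (eventually_contMDiffAt_form_apply hX.form_smooth hA).self_of_nhds
    rw [h1, nab.apply_smul (h2.mdifferentiableAt (by simp)) (hX.smoothFieldNear x).diffFieldAt,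
      hX.recurrent]
  -- The terms quadratic in `Θ` are symmetric in `V` and `W` and cancel.
  rw [curvatureField, key hV, key hW, hX.recurrent]
  module

theorem IsRicciIsotropic.curv_eq_zero [T2Space M] (hnab : h.IsLeviCivita nab)
    (hiso : h.IsRicciIsotropic nab) (hX : h.IsPRField nab X Θ) (u v : TangentSpace (𝓡 d) x) :
    curv nab x u v (X x) = 0 :=
  (hnab.isCurvatureLike x).apply_null_eq_zero_of_isotropic (h.isLorentzian x) (h.isDualFrame x)
    (hX.lightlike.ne_zero x (Set.mem_univ x)) (hX.lightlike.null x (Set.mem_univ x))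
    (hX.curvature x) (hiso x) u v

theorem IsRicciIsotropic.closed [T2Space M] (hnab : h.IsLeviCivita nab)
    (hiso : h.IsRicciIsotropic nab) (hX : h.IsPRField nab X Θ)
    (V W : Π x : M, TangentSpace (𝓡 d) x) (x : M) (hV : SmoothFieldNear V x)
    (hW : SmoothFieldNear W x) :
    mvfderiv (𝓡 d) (fun y ↦ Θ y (W y)) x (V x) - mvfderiv (𝓡 d) (fun y ↦ Θ y (V y)) x (W x)
        - Θ x (mlieBracket (𝓡 d) V W x) = 0 := by
  have h1 := hX.curvatureField_eq hV hW
  rw [hnab.curvatureField_eq_curv hV hW (hX.smoothFieldNear x), hiso.curv_eq_zero hnab hX] at h1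
  exact (smul_eq_zero.1 h1.symm).resolve_right (hX.lightlike.ne_zero x (Set.mem_univ x))

/-- Rescaling by `exp (-g)` with `dg = Θ` makes a recurrent field parallel. -/
theorem IsPRField.canRescaleToParallelOn (hX : h.IsPRField nab X Θ) {U : Set M} (hU : IsOpen U)
    {g : M → ℝ} (hg : ContMDiffOn (𝓡 d) 𝓘(ℝ) ∞ g U) (hgΘ : ∀ x ∈ U, mvfderiv (𝓡 d) g x = Θ x) :
    CanRescaleToParallelOn nab X U := by
  have hexp : ContMDiff 𝓘(ℝ) 𝓘(ℝ) ∞ fun t : ℝ ↦ Real.exp (-t) :=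
    (Real.contDiff_exp.comp contDiff_neg).contMDiff
  have hf : ContMDiffOn (𝓡 d) 𝓘(ℝ) ∞ (fun x ↦ Real.exp (-g x)) U :=
    hexp.comp_contMDiffOn hg
  refine ⟨_, hf, fun x _ ↦ Real.exp_pos _, fun x hx u ↦ ?_⟩
  have hgx : MDifferentiableAt (𝓡 d) 𝓘(ℝ) g x :=
    (hg.contMDiffAt (hU.mem_nhds hx)).mdifferentiableAt (by simp)
  have hd : mvfderiv (𝓡 d) (fun x ↦ Real.exp (-g x)) x u = -Real.exp (-g x) * Θ x u := by
    have h1 : HasDerivAt (fun t : ℝ ↦ Real.exp (-t)) (-Real.exp (-g x)) (g x) := by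
      simpa using (hasDerivAt_neg (g x)).exp
    have h2 := mvfderiv_comp_apply (I' := 𝓡 d) x (hexp.mdifferentiable (by simp) (g x)) hgx u
    have h3 (t : ℝ) : mvfderiv 𝓘(ℝ) (fun t : ℝ ↦ Real.exp (-t)) (g x) t =
        -Real.exp (-g x) * t := by
      simp only [mvfderiv, mfderiv_eq_fderiv, h1.hasFDerivAt.fderiv]
      exact mul_comm _ _
    refine h2.trans ((h3 _).trans ?_)
    rw [← hgΘ x hx]
    rfl
  rw [nab.apply_smul ((hf.contMDiffAt (hU.mem_nhds hx)).mdifferentiableAt (by simp))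
    (hX.smoothFieldNear x).diffFieldAt, hX.recurrent, hd]
  module

/-- The rescaled field is the parallel null field required; the trace condition is pointwise and is
checked with the original `X`. -/
theorem IsRicciIsotropic.isPPWaveOn [T2Space M] (hnab : h.IsLeviCivita nab)
    (hiso : h.IsRicciIsotropic nab) (hX : h.IsPRField nab X Θ) {U : Set M}
    (hXU : CanRescaleToParallelOn nab X U) : h.IsPPWaveOn nab U := by
  obtain ⟨f, hf, hf0, hpar⟩ := hXU
  refine ⟨⟨_, ⟨?_, fun x hx ↦ ?_, fun x hx ↦ ?_⟩, hpar⟩, fun x hx y₁ y₂ y₃ y₄ ↦ ?_⟩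
  · exact hf.smul_section (hX.lightlike.smooth.mono (Set.subset_univ U))
  · exact smul_ne_zero (hf0 x hx).ne' (hX.lightlike.ne_zero x (Set.mem_univ x))
  · simp [hX.lightlike.null x (Set.mem_univ x)]
  · exact (hnab.isCurvatureLike x).trace_eq_zero (h.isLorentzian x) (h.isDualFrame x)
      (hX.lightlike.ne_zero x (Set.mem_univ x)) (hX.lightlike.null x (Set.mem_univ x))
      (hX.curvature x) (fun u v ↦ hiso.curv_eq_zero hnab hX u v) y₁ y₂ y₃ y₄

/-- A parallel field is annihilated by the curvature. -/
theorem IsParallelOn.curv_eq_zero [T2Space M] (hnab : h.IsLeviCivita nab) {U : Set M}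
    (hU : IsOpen U) (hXs : SmoothFieldOn X U) (hX : IsParallelOn nab X U) (hx : x ∈ U)
    (u v : TangentSpace (𝓡 d) x) : curv nab x u v (X x) = 0 := by
  have hu := SmoothFieldNear.extend u
  have hv := SmoothFieldNear.extend v
  have hXx := hXs.near hU hx
  have key {A : Π x : M, TangentSpace (𝓡 d) x} (hA : SmoothFieldNear A x) :
      nab (fun y ↦ nab X y (A y)) x = 0 := by
    have h1 : (fun y ↦ nab X y (A y)) =ᶠ[𝓝 x] (0 : Π x : M, TangentSpace (𝓡 d) x) := by
      filter_upwards [hU.mem_nhds hx] with y hy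
      exact hX y hy _
    rw [nab.congr (hXx.nab_apply hnab.smooth hA).diffFieldAt
      (mdifferentiableAt_zeroSection ..) h1]
    exact congrFun (CovariantDerivative.zero nab) x
  have h2 := hnab.curvatureField_eq_curv hu hv hXx
  rw [extend_apply_self, extend_apply_self] at h2
  rw [← h2, curvatureField, key hu, key hv, hX x hx]
  simp

/-- The argument runs with the parallel field of the pp-wave: the curvature kills it, and the trace
condition supplies the property of mapping its orthogonal complement into its span. -/
theorem IsPPWaveOn.isotropic_at [T2Space M] (hnab : h.IsLeviCivita nab) {U : Set M}
    (hU : IsOpen U) (hpp : h.IsPPWaveOn nab U) (hx : x ∈ U) (u v : TangentSpace (𝓡 d) x) :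
    h.val x (h.ricEnd nab x u) (h.ricEnd nab x v) = 0 := by
  obtain ⟨⟨X, hX, hpar⟩, htr⟩ := hpp
  have hR := hnab.isCurvatureLike x
  have hRX (u v) : curv nab x u v (X x) = 0 := hpar.curv_eq_zero hnab hU hX.smooth hx u v
  have : FiniteDimensional ℝ (TangentSpace (𝓡 d) x) :=
    inferInstanceAs (FiniteDimensional ℝ (EuclideanSpace ℝ (Fin d)))
  exact hR.isotropic_of_apply_null_eq_zero (h.isLorentzian x) (h.isDualFrame x) (hX.ne_zero x hx)
    (hX.null x hx) (hR.exists_eq_smul_of_trace_eq_zero (h.isLorentzian x) (h.isDualFrame x)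
      (hX.ne_zero x hx) (hX.null x hx) hRX (htr x hx)) hRX u v

theorem IsRicciIsotropic.exists_nhds_canRescale [T2Space M] (hnab : h.IsLeviCivita nab)
    (hiso : h.IsRicciIsotropic nab) (hX : h.IsPRField nab X Θ) (p : M) :
    ∃ U : Set M, IsOpen U ∧ p ∈ U ∧ CanRescaleToParallelOn nab X U := by
  obtain ⟨U, hU, hp, g, hg, hgΘ⟩ :=
    exists_local_primitive hX.form_smooth (hiso.closed hnab hX) p
  exact ⟨U, hU, hp, hX.canRescaleToParallelOn hU hg hgΘ⟩

theorem IsRicciIsotropic.canRescale [T2Space M] [SimplyConnectedSpace M]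
    (hnab : h.IsLeviCivita nab) (hiso : h.IsRicciIsotropic nab) (hX : h.IsPRField nab X Θ) :
    CanRescaleToParallelOn nab X Set.univ := by
  obtain ⟨g, hg, hgΘ⟩ := exists_primitive
    (exists_local_primitive hX.form_smooth (hiso.closed hnab hX))
  exact hX.canRescaleToParallelOn isOpen_univ hg.contMDiffOn fun x _ ↦ hgΘ x

end LorentzianMetric

end PRWave

theorem proposition6p11 {d : ℕ} {M : Type*} [TopologicalSpace M] [T2Space M]
    [SecondCountableTopology M] [ChartedSpace (EuclideanSpace ℝ (Fin d)) M]
    [IsManifold (𝓡 d) ∞ M]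
    (h : LorentzianMetric d M) (nab : AffineConnection d M) (hnab : h.IsLeviCivita nab)
    (hpr : h.IsPRWave nab) :
    (h.IsLocallyPPWave nab ↔ h.IsRicciIsotropic nab) ∧
    (SimplyConnectedSpace M → (h.IsPPWave nab ↔ h.IsRicciIsotropic nab)) ∧
    (h.IsRicciIsotropic nab →
      ∀ (X : Π x : M, TangentSpace (𝓡 d) x) (Θ : Π x : M, TangentSpace (𝓡 d) x →L[ℝ] ℝ),
        h.IsPRField nab X Θ →
          IsClosedForm Θ ∧
          (∀ p : M, ∃ U : Set M, IsOpen U ∧ p ∈ U ∧ CanRescaleToParallelOn nab X U) ∧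
          (SimplyConnectedSpace M → CanRescaleToParallelOn nab X Set.univ)) := by
  obtain ⟨X, Θ, hX⟩ := hpr
  refine ⟨⟨fun hpp x u v ↦ ?_, fun hiso p ↦ ?_⟩,
    fun _ ↦ ⟨fun hpp x u v ↦ hpp.isotropic_at hnab isOpen_univ (Set.mem_univ x) u v,
      fun hiso ↦ hiso.isPPWaveOn hnab hX (hiso.canRescale hnab hX)⟩,
    fun hiso X Θ hX ↦ ⟨fun V W hV hW x ↦ hiso.closed hnab hX V W x
      (hV.near isOpen_univ (Set.mem_univ x)) (hW.near isOpen_univ (Set.mem_univ x)),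
      hiso.exists_nhds_canRescale hnab hX, fun _ ↦ hiso.canRescale hnab hX⟩⟩
  · obtain ⟨U, hU, hx, hppU⟩ := hpp x
    exact hppU.isotropic_at hnab hU hx u v
  · obtain ⟨U, hU, hp, hXU⟩ := hiso.exists_nhds_canRescale hnab hX p
    exact ⟨U, hU, hp, hiso.isPPWaveOn hnab hX hXU⟩
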